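/- Let $X_{free}\subset\mathbb{R}^2$ be a compact polygonal region, i.e. a compact set that is the closure of its interior and whose boundary is a finite disjoint union of simple closed polygons (several components and holes are allowed). Let a convex division of $X_{free}$ be given: finitely many convex polygons (cells) with non-empty, pairwise disjoint interiors, whose union is $X_{free}$ and whose vertices are all vertices of the boundary polygons of $X_{free}$. Two distinct cells are adjacent if they share a nondegenerate segment (a cutline); let $X_{topo}$ be the resulting graph on the cells. A path in $X_{topo}$ is a finite non-empty sequence of cells in which consecutive entries are equal or adjacent. Two paths in $X_{topo}$ with the same ends are homotopic ($\simeq_p$) if one is obtained from the other by finitely many replacements of an entry $x$ by $(x,x)$ or $(x,y,x)$ and inverse replacements, and time homotopic ($\cong_p$) if one of them arises from the other by repeating entries. The product $*$ is concatenation with the common end entry listed once, and $\overline{\mathrm f}$ is the reversed sequence. A path $\mathrm f$ in $X_{topo}$ has no rollback if it is not $\cong_p \mathrm f_1*\mathrm f_2*\overline{\mathrm f_2}*\mathrm f_3$ with $\mathrm f_2$ non-constant. For a path $f$ in $X_{free}$, $\Gamma\circ f$ is the sequence of cells that $f$ passes through (if $[0,1]$ can be cut into finitely many successive intervals on each of which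 $f$ stays in one cell, consecutive cells being equal or adjacent), and $\Gamma^*\circ f$ is the no rollback path homotopic to $\Gamma\circ f$; if $f$ has no finite sequence of cells, that of any path homotopic to $f$ is used. (If an endpoint of $f$ or a piece of $f$ lies in several cells, any admissible choice of cells is allowed.) Let $S$ denote Euclidean length (total variation), and let $f^*$ denote a shortest path in the homotopy class $[f]$ of $f$ in $X_{free}$ relative to the endpoints. Theorem. Let $x_0,x_1\in X_{free}$ and let $f,g$ be paths in $X_{free}$ from $x_0$ to $x_1$. Suppose that there are paths $\mathrm h_1,\mathrm h_2,\mathrm h_3$ in $X_{topo}$, where $\mathrm h_1$ ends at a cell $\mathrm x$, $\mathrm h_2$ is a loop at $\mathrm x$ and $\mathrm h_3$ starts at $\mathrm x$, such that $$\Gamma^*\circ f\cong_p \mathrm h_1*\mathrm h_2*\mathrm h_3\quad\text{and}\quad \Gamma^*\circ g\cong_p \mathrm h_1*\mathrm h_3 .$$ Then $S(f^*)\ge S(g^*)$. -/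

import Mathlib

open Set
open scoped ENNReal unitInterval

namespace ConvexDissection

/-- The Euclidean plane. -/
abbrev Plane : Type := EuclideanSpace ℝ (Fin 2)

/-! ### Polygonal free space -/

/-- The boundary of `P` is a simple closed polygon: the vertices are distinct, consecutive edges
meet exactly in their common vertex, and all other pairs of distinct edges are disjoint. -/
structure IsSimplePolygon {n : ℕ} (P : Polygon Plane n) : Prop where
  three_le : 3 ≤ n
  injective : Function.Injective P.vertices
  inter_next : ∀ i : Fin n,
    P.edgeSet ℝ i ∩ P.edgeSet ℝ (finRotate n i) = {P.vertices (finRotate n i)}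
  disjoint : ∀ i j : Fin n, j ≠ i → j ≠ finRotate n i → i ≠ finRotate n j →
    Disjoint (P.edgeSet ℝ i) (P.edgeSet ℝ j)

/-- A bounded polygonal free space: a compact subset of the plane, without lower dimensional
parts, whose boundary is the union of finitely many pairwise disjoint simple closed polygons.
Several connected components and holes are allowed. -/
structure PolygonalRegion where
  carrier : Set Plane
  isCompact : IsCompact carrier
  closure_interior : closure (interior carrier) = carrier
  numLoops : ℕ
  sides : Fin numLoops → ℕ
  loop : ∀ k : Fin numLoops, Polygon Plane (sides k)
  loop_simple : ∀ k, IsSimplePolygon (loop k)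
  loop_disjoint : ∀ k l, k ≠ l → Disjoint ((loop k).boundary ℝ) ((loop l).boundary ℝ)
  frontier_eq : frontier carrier = ⋃ k, (loop k).boundary ℝ

/-- The set of vertices of the boundary polygons. -/
def PolygonalRegion.vertexSet (X : PolygonalRegion) : Set Plane :=
  ⋃ k, Set.range (X.loop k).vertices

/-- A convex division of a polygonal region: the region is the union of convex polygons (with
non-empty, pairwise disjoint interiors), and no new vertices are created. -/
structure ConvexDivision (X : PolygonalRegion) (ι : Type*) where
  cell : ι → Set Plane
  cell_polygon : ∀ i, ∃ V : Finset Plane, cell i = convexHull ℝ (V : Set Plane)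
  cell_interior_nonempty : ∀ i, (interior (cell i)).Nonempty
  cell_interior_disjoint : ∀ i j, i ≠ j → Disjoint (interior (cell i)) (interior (cell j))
  iUnion_cell : ⋃ i, cell i = X.carrier
  no_new_vertices : ∀ i, (cell i).extremePoints ℝ ⊆ X.vertexSet

/-- The common part of two cells. For distinct cells this is a convex set without interior; if it
has more than one point, it is a segment and is the cutline between the two cells. -/
def ConvexDivision.cutline {X : PolygonalRegion} {ι : Type*} (D : ConvexDivision X ι)
    (i j : ι) : Set Plane :=
  D.cell i ∩ D.cell j

/-- The topological graph: its nodes are the convex polygons, and two of them are adjacent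
if a (nondegenerate) cutline separates them. -/
def ConvexDivision.graph {X : PolygonalRegion} {ι : Type*} (D : ConvexDivision X ι) :
    SimpleGraph ι where
  Adj i j := i ≠ j ∧ (D.cutline i j).Nontrivial
  symm := ⟨fun i j h => ⟨h.1.symm, by
    simpa only [ConvexDivision.cutline, Set.inter_comm] using h.2⟩⟩
  loopless := ⟨fun _ h => h.1 rfl⟩

/-! ### Paths in the topological graph -/

/-- A path from `x` to `y` in a graph: a finite non-empty sequence of nodes that starts at `x`,
ends at `y`, and in which any two consecutive nodes are equal or adjacent. -/
structure TopoPath {V : Type*} (G : SimpleGraph V) (x y : V) where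
  nodes : List V
  chain : nodes.IsChain (fun a b => a = b ∨ G.Adj a b)
  head_eq : nodes.head? = some x
  last_eq : nodes.getLast? = some y

namespace TopoPath

variable {V : Type*} {G : SimpleGraph V} {x y z : V}

/-- The product: the end node of `p`, which is the start node of `q`, is listed once. -/
def mul (p : TopoPath G x y) (q : TopoPath G y z) : TopoPath G x z where
  nodes := p.nodes ++ q.nodes.tail
  chain := by
    obtain ⟨l, hl, hx, hy⟩ := p
    obtain ⟨m, hm, hy', hz⟩ := q
    rcases m with _ | ⟨a, m⟩
    · simp at hy'
    · obtain rfl : a = y := by simpa using hy'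
      refine List.isChain_append.2 ⟨hl, hm.tail, ?_⟩
      intro u hu v hv
      obtain rfl : a = u := by simpa [hy] using hu
      rcases m with _ | ⟨b, m⟩
      · simp at hv
      · obtain rfl : b = v := by simpa using hv
        exact (List.isChain_cons_cons.1 hm).1
  head_eq := by
    rw [List.head?_append, p.head_eq]; rfl
  last_eq := by
    obtain ⟨m, hm, hy', hz⟩ := q
    rcases m with _ | ⟨a, m⟩
    · simp at hy'
    · obtain rfl : a = y := by simpa using hy'
      rcases m with _ | ⟨b, m⟩
      · have : a = z := by simpa using hz
        simpa [this] using p.last_eq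
      · simpa [List.getLast?_append, List.getLast?_cons_cons] using hz

/-- The inverse path. -/
def inv (p : TopoPath G x y) : TopoPath G y x where
  nodes := p.nodes.reverse
  chain := by
    refine List.isChain_reverse.2 (p.chain.imp ?_)
    intro a b h
    exact h.imp Eq.symm fun h => h.symm
  head_eq := by simpa using p.last_eq
  last_eq := by simpa using p.head_eq

/-- `q` arises from `p` by an extension: one entry `a` of the sequence is replaced by `a, a` or by
`a, b, a`. -/
def Extends (p q : TopoPath G x y) : Prop :=
  ∃ (l r : List V) (a : V), p.nodes = l ++ a :: r ∧
    (q.nodes = l ++ a :: a :: r ∨ ∃ b, q.nodes = l ++ a :: b :: a :: r)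

/-- Path homotopy: a finite sequence of extensions and contractions. -/
def Homotopic : TopoPath G x y → TopoPath G x y → Prop :=
  Relation.ReflTransGen fun p q => p.Extends q ∨ q.Extends p

/-- `p` is a monotone reparametrisation of `q`, i.e. it arises from `q` by repeating entries. -/
def IsReparam (p q : TopoPath G x y) : Prop :=
  ∃ φ : Fin p.nodes.length → Fin q.nodes.length, Monotone φ ∧ Function.Surjective φ ∧
    ∀ t, p.nodes.get t = q.nodes.get (φ t)

/-- Path time homotopy. -/
def TimeHomotopic (p q : TopoPath G x y) : Prop :=
  p.IsReparam q ∨ q.IsReparam p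

/-- The path stays at its first node, i.e. it is an identity element up to time homotopy. -/
def IsConstant (p : TopoPath G x y) : Prop :=
  ∀ v ∈ p.nodes, v = x

/-- `f` cannot be written, up to time homotopy, as `f₁ * f₂ * f₂⁻¹ * f₃` with `f₂` not an identity
element. -/
def NoRollback (f : TopoPath G x y) : Prop :=
  ¬ ∃ (a b : V) (f₁ : TopoPath G x a) (f₂ : TopoPath G a b) (f₃ : TopoPath G a y),
    ¬ f₂.IsConstant ∧ f.TimeHomotopic (((f₁.mul f₂).mul f₂.inv).mul f₃)

end TopoPath

/-! ### Codes of paths in the free space -/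

namespace ConvexDivision

variable {X : PolygonalRegion} {ι : Type*} (D : ConvexDivision X ι)
  {x₀ x₁ : X.carrier} {i j : ι}

/-- `u` is the sequence of cells that `f` passes through: the unit interval is cut into finitely
many successive intervals, and on the `k`-th of them `f` runs in the `k`-th cell of `u`. Since
consecutive cells of `u` are adjacent, `f` changes from one to the next on their cutline. -/
def IsCode (f : Path x₀ x₁) (u : TopoPath D.graph i j) : Prop :=
  ∃ t : Fin (u.nodes.length + 1) → I, Monotone t ∧ t 0 = 0 ∧ t (Fin.last _) = 1 ∧
    ∀ k : Fin u.nodes.length, ∀ s ∈ Set.Icc (t k.castSucc) (t k.succ),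
      (f s : Plane) ∈ D.cell (u.nodes.get k)

/-- `r` is the no rollback path that encodes the homotopy class of `f`: it has no rollback, and it
is homotopic to the sequence of cells of `f`, or, as `f` may cross a cutline infinitely often and
then has no finite sequence of cells, of some path that is homotopic to `f`. -/
def IsReducedCode (f : Path x₀ x₁) (r : TopoPath D.graph i j) : Prop :=
  r.NoRollback ∧ ∃ (f' : Path x₀ x₁) (u : TopoPath D.graph i j),
    f.Homotopic f' ∧ D.IsCode f' u ∧ u.Homotopic r

end ConvexDivision

/-- The Euclidean length of a path in the free space (`∞` if it is not rectifiable). -/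
noncomputable def pathLength {X : PolygonalRegion} {x₀ x₁ : X.carrier} (f : Path x₀ x₁) : ℝ≥0∞ :=
  eVariationOn (fun t : I => (f t : Plane)) Set.univ

/-- `f'` is a shortest path in the homotopy class of `f` (homotopies run in the free space and fix
the endpoints). -/
def IsShortestInClass {X : PolygonalRegion} {x₀ x₁ : X.carrier} (f f' : Path x₀ x₁) : Prop :=
  f.Homotopic f' ∧ ∀ f'' : Path x₀ x₁, f.Homotopic f'' → pathLength f' ≤ pathLength f''

end ConvexDissection

/-! A walk through convex cells fixes a homotopy class of paths: two choices of crossing points on a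
cutline are joined inside both cells (`Codes.eq`). Conversely, once the initial cell is fixed, the
reduced walk depends only on the homotopy class. For this, a covering of the region is built whose
fibre is the discrete set of reduced lists of cells (`coveringCore`). Passing from a cell to an
adjacent one at a common point multiplies the coordinate by a permutation that prolongs or shortens
the list by one step. Such data glue to a covering because the cells at any point form a forest
under adjacency (`exists_adj_subsingleton`) and are linked to each other by adjacencies at that
point (`reflTransGen_adj_of_mem`). Both facts rest on the absence of new vertices and on the
boundary being made of disjoint simple polygons. Homotopic paths lift to the same end
(`exists_isLift`).

Every path can be lifted, even a shortest path without a finite sequence of cells. The lift of `f*`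
starts at the one-entry walk `[i]` and ends at the reduced walk of `h₁ * h₂ * h₃`. Reduced walks
form a tree-like structure in which a walk cannot be prolonged past one of its initial parts without
visiting it. So `f*` meets the sheet of `h₁` at a time `s` and, later or at the same time, the sheet
of `h₁ * h₂` at a time `t` (`IsLift.exists_eq`). At both times it is in the cell at which `h₂` is
based. Replacing the piece between `s` and `t` by a segment of this convex cell does not increase
the length, and the new path is coded by `h₁ * h₃`. It is therefore homotopic to `g`, and its length
bounds that of `g*`. -/

namespace ConvexDissection

/-! ### Reduced lists and the removal of repetitions -/

section Lists

variable {V : Type*}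

/-- No entry of the list is repeated two places further on. -/
def Reduced : List V → Prop
  | a :: b :: c :: l => a ≠ c ∧ Reduced (b :: c :: l)
  | _ => True

/-- Move to the node `c` from the end of a walk, which is listed backwards: going back along the
last step of the walk erases this step. -/
noncomputable def step (c : V) : List V → List V
  | [] => [c]
  | [a] => open Classical in if a = c then [a] else [c, a]
  | a :: b :: l => open Classical in
    if a = c then a :: b :: l else if b = c then b :: l else c :: a :: b :: l

/-- Prepend `c` unless it is the first entry already. -/
noncomputable def push (c : V) : List V → List V
  | [] => [c]
  | a :: l => open Classical in if a = c then a :: l else c :: a :: l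

/-- The reduced form of a walk, listed backwards. -/
noncomputable def dev (l : List V) : List V := l.foldl (fun L c => step c L) []

/-- The walk without consecutive repetitions, listed backwards. -/
noncomputable def des (l : List V) : List V := l.foldl (fun L c => push c L) []

theorem Reduced.tail {a : V} {l : List V} (h : Reduced (a :: l)) : Reduced l := by
  rcases l with _ | ⟨b, _ | ⟨c, l⟩⟩
  · trivial
  · trivial
  · exact h.2

theorem Reduced.of_suffix {l m : List V} (h : l <:+ m) (hm : Reduced m) : Reduced l := by
  obtain ⟨s, rfl⟩ := h
  induction s with
  | nil => exact hm
  | cons a s ih => exact ih (Reduced.tail hm)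

theorem head?_step (c : V) (L : List V) : (step c L).head? = some c := by
  rcases L with _ | ⟨a, _ | ⟨b, l⟩⟩
  · rfl
  · by_cases h : a = c <;> simp [step, h]
  · by_cases h : a = c
    · simp [step, h]
    · by_cases h' : b = c <;> simp [step, h, h']

theorem step_eq_self {c : V} {L : List V} (h : L.head? = some c) : step c L = L := by
  rcases L with _ | ⟨a, _ | ⟨b, l⟩⟩
  · simp at h
  · simp_all [step]
  · simp_all [step]

theorem Reduced.step {L : List V} (h : Reduced L) (c : V) : Reduced (step c L) := by
  rcases L with _ | ⟨a, _ | ⟨b, l⟩⟩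
  · trivial
  · by_cases h : a = c <;> simp [ConvexDissection.step, h, Reduced]
  · by_cases h1 : a = c
    · simpa [ConvexDissection.step, h1] using h1 ▸ h
    · by_cases h2 : b = c
      · simpa [ConvexDissection.step, h1, h2] using h2 ▸ h.tail
      · simp only [ConvexDissection.step, h1, h2, if_false]
        exact ⟨fun e => h2 e.symm, h⟩

/-- Moving away and back cancels. Reducedness matters when the first move erases the head: the entry
two places after it differs from `a`, so the return restores the head instead of erasing once more.
-/
theorem step_step {L : List V} (hL : Reduced L) {a c : V} (ha : L.head? = some a) :
    step a (step c L) = L := by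
  rcases L with _ | ⟨a', _ | ⟨b, l⟩⟩
  · simp at ha
  · obtain rfl : a' = a := by simpa using ha
    by_cases h : a' = c <;> simp_all [step, eq_comm]
  · obtain rfl : a' = a := by simpa using ha
    by_cases h1 : a' = c
    · simp [step, h1]
    · by_cases h2 : b = c
      · subst h2
        rcases l with _ | ⟨d, l⟩
        · simp [step, h1, Ne.symm h1]
        · have hd : d ≠ a' := fun e => hL.1 e.symm
          simp [step, h1, Ne.symm h1, hd]
      · simp [step, h1, h2, Ne.symm h1]

/-- The two operations differ only when `step` would erase, and in that case `push` creates a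
pattern `c, a, c`, which is not reduced. -/
theorem step_eq_push {L : List V} {c : V} (h : Reduced (push c L)) : step c L = push c L := by
  rcases L with _ | ⟨a, _ | ⟨b, l⟩⟩
  · rfl
  · simp [step, push]
  · by_cases h1 : a = c
    · simp [step, push, h1]
    · by_cases h2 : b = c
      · simp [push, h1, h2, Reduced] at h
      · simp [step, push, h1, h2]

theorem dev_append (l m : List V) : dev (l ++ m) = m.foldl (fun L c => step c L) (dev l) := by
  simp [dev, List.foldl_append]

theorem des_append (l m : List V) : des (l ++ m) = m.foldl (fun L c => push c L) (des l) := by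
  simp [des, List.foldl_append]

theorem dev_concat (l : List V) (c : V) : dev (l ++ [c]) = step c (dev l) := by
  simp [dev_append]

theorem des_concat (l : List V) (c : V) : des (l ++ [c]) = push c (des l) := by
  simp [des_append]

theorem reduced_dev (l : List V) : Reduced (dev l) := by
  induction l using List.reverseRecOn with
  | nil => trivial
  | append_singleton l a ih => rw [dev_concat]; exact ih.step a

theorem head?_push (c : V) (L : List V) : (push c L).head? = some c := by
  rcases L with _ | ⟨a, l⟩
  · rfl
  · by_cases h : a = c <;> simp [push, h]

theorem head?_des (l : List V) : (des l).head? = l.getLast? := by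
  induction l using List.reverseRecOn with
  | nil => rfl
  | append_singleton l a ih => rw [des_concat, head?_push]; simp

theorem suffix_push (c : V) (L : List V) : L <:+ push c L := by
  rcases L with _ | ⟨a, l⟩
  · exact List.nil_suffix
  · by_cases h : a = c
    · simp [push, h]
    · simp [push, h]

theorem dev_eq_des {l : List V} (h : Reduced (des l)) : dev l = des l := by
  induction l using List.reverseRecOn with
  | nil => rfl
  | append_singleton l a ih =>
    rw [des_concat] at h ⊢
    rw [dev_concat, ih (h.of_suffix (suffix_push a _)), step_eq_push h]

theorem push_eq_self {c : V} {L : List V} (h : L.head? = some c) : push c L = L := by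
  rcases L with _ | ⟨a, l⟩
  · simp at h
  · simp_all [push]

theorem isChain_ne_des (l : List V) : (des l).IsChain (· ≠ ·) := by
  induction l using List.reverseRecOn with
  | nil => exact List.isChain_nil
  | append_singleton l a ih =>
    rw [des_concat]
    rcases h : des l with _ | ⟨b, m⟩
    · simp [push]
    · rw [h] at ih
      by_cases hb : b = a
      · simpa [push, hb] using hb ▸ ih
      · simp only [push, hb, if_false]
        exact List.isChain_cons_cons.2 ⟨fun e => hb e.symm, ih⟩

theorem exists_of_not_reduced {L : List V} (h : ¬ Reduced L) :
    ∃ s a b t, L = s ++ a :: b :: a :: t := by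
  induction L with
  | nil => exact absurd trivial h
  | cons a l ih =>
    rcases l with _ | ⟨b, _ | ⟨c, l⟩⟩
    · exact absurd trivial h
    · exact absurd trivial h
    · by_cases hac : a = c
      · subst hac; exact ⟨[], a, b, l, rfl⟩
      · obtain ⟨s, x, y, t, e⟩ := ih fun h' => h ⟨hac, h'⟩
        exact ⟨a :: s, x, y, t, by rw [e]; rfl⟩

/-- `p` arises from `q` by repeating entries. -/
inductive Repeats : List V → List V → Prop
  | nil : Repeats [] []
  | dup {a p q} : Repeats (a :: p) (a :: q) → Repeats (a :: a :: p) (a :: q)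
  | cons {a p q} : Repeats p q → Repeats (a :: p) (a :: q)

theorem Repeats.of_map : ∀ {p q : List V} (φ : Fin p.length → Fin q.length), Monotone φ →
    Function.Surjective φ → (∀ t, p.get t = q.get (φ t)) → Repeats p q
  | [], [], _, _, _, _ => .nil
  | [], b :: q, φ, _, hs, _ => by obtain ⟨i, -⟩ := hs ⟨0, by simp⟩; exact i.elim0
  | a :: p, [], φ, _, _, _ => (φ ⟨0, by simp⟩).elim0
  | a :: p, b :: q, φ, hm, hs, hg => by
    have h0 : φ (0 : Fin (p.length + 1)) = (0 : Fin (q.length + 1)) := by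
      obtain ⟨i, hi⟩ := hs (0 : Fin (q.length + 1))
      exact le_antisymm (hi ▸ hm (Fin.zero_le i)) (Fin.zero_le _)
    obtain rfl : a = b := by
      have := hg (0 : Fin (p.length + 1))
      rw [h0] at this
      simpa using this
    -- If any later index is sent to `0`, monotonicity sends index `1` there as well, so the first
    -- entry is a repetition. Otherwise all later values are positive and can be shifted down by
    -- one.
    by_cases h : ∃ i : Fin p.length, φ i.succ = (0 : Fin (q.length + 1))
    · obtain ⟨i, hi⟩ := h
      rcases p with _ | ⟨c, p⟩
      · exact i.elim0
      · have h1 : φ (1 : Fin (p.length + 2)) = (0 : Fin (q.length + 1)) := by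
          refine le_antisymm (hi ▸ hm ?_) (Fin.zero_le _)
          exact Fin.succ_le_succ_iff.2 (Fin.zero_le i)
        obtain rfl : c = a := by
          have := hg (1 : Fin (p.length + 2))
          rw [h1] at this
          simpa using this
        refine .dup (Repeats.of_map (fun i => φ i.succ) ?_ ?_ ?_)
        · exact fun i j hij => hm (Fin.succ_le_succ_iff.2 hij)
        · intro j
          obtain ⟨i, hi⟩ := hs j
          induction i using Fin.cases with
          | zero => exact ⟨(0 : Fin (p.length + 1)), by rw [← hi, h0]; exact h1⟩
          | succ i => exact ⟨i, hi⟩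
        · intro t
          simpa using hg t.succ
    · push Not at h
      refine .cons (Repeats.of_map (fun i => (φ i.succ).pred (h i)) ?_ ?_ ?_)
      · exact fun i j hij => Fin.pred_le_pred_iff.2 (hm (Fin.succ_le_succ_iff.2 hij))
      · intro j
        obtain ⟨i, hi⟩ := hs j.succ
        induction i using Fin.cases with
        | zero => rw [h0] at hi; exact absurd hi.symm (Fin.succ_ne_zero j)
        | succ i => exact ⟨i, by simp [hi]⟩
      · intro t
        have e : (a :: q).get (φ t.succ) = (a :: q).get ((φ t.succ).pred (h t)).succ := by
          rw [Fin.succ_pred]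
        exact (hg t.succ).trans e

theorem Repeats.exists_map {p q : List V} (h : Repeats p q) :
    ∃ φ : Fin p.length → Fin q.length, Monotone φ ∧ Function.Surjective φ ∧
      ∀ t, p.get t = q.get (φ t) := by
  induction h with
  | nil => exact ⟨id, monotone_id, Function.surjective_id, fun t => rfl⟩
  | @dup a p q _ ih =>
    obtain ⟨φ, hm, hs, hg⟩ := ih
    refine ⟨Fin.cases (0 : Fin (q.length + 1)) φ, ?_, ?_, ?_⟩
    · intro i j hij
      induction i using Fin.cases with
      | zero => exact Fin.zero_le _
      | succ i =>
        induction j using Fin.cases with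
        | zero => exact absurd hij (by simp)
        | succ j => exact hm (Fin.succ_le_succ_iff.1 hij)
    · intro j
      obtain ⟨i, hi⟩ := hs j
      exact ⟨i.succ, hi⟩
    · intro t
      induction t using Fin.cases with
      | zero => rfl
      | succ t => exact hg t
  | @cons a p q _ ih =>
    obtain ⟨φ, hm, hs, hg⟩ := ih
    refine ⟨Fin.cases (0 : Fin (q.length + 1)) fun i => (φ i).succ, ?_, ?_, ?_⟩
    · intro i j hij
      induction i using Fin.cases with
      | zero => exact Fin.zero_le _
      | succ i =>
        induction j using Fin.cases with
        | zero => exact absurd hij (by simp)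
        | succ j => exact Fin.succ_le_succ_iff.2 (hm (Fin.succ_le_succ_iff.1 hij))
    · intro j
      induction j using Fin.cases with
      | zero => exact ⟨(0 : Fin (p.length + 1)), rfl⟩
      | succ j =>
        obtain ⟨i, hi⟩ := hs j
        exact ⟨i.succ, congrArg Fin.succ hi⟩
    · intro t
      induction t using Fin.cases with
      | zero => rfl
      | succ t => exact hg t

theorem Repeats.des_eq {p q : List V} (h : Repeats p q) : des p = des q := by
  suffices ∀ acc, p.foldl (fun L c => push c L) acc = q.foldl (fun L c => push c L) acc from this []
  induction h with
  | nil => exact fun _ => rfl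
  | @dup a p q _ ih =>
    intro acc
    rw [List.foldl_cons, ih, List.foldl_cons, List.foldl_cons, push_eq_self (head?_push a acc)]
  | cons _ ih => exact fun acc => ih _

theorem Repeats.concat {p q : List V} (h : Repeats p q) (a : V) :
    Repeats (p ++ [a]) (q ++ [a]) := by
  induction h with
  | nil => exact .cons .nil
  | dup _ ih => exact .dup ih
  | cons _ ih => exact .cons ih

theorem Repeats.concat_dup {p q : List V} {a : V} (h : Repeats p q) (ha : q.getLast? = some a) :
    Repeats (p ++ [a]) q := by
  induction h with
  | nil => simp at ha
  | dup _ ih => exact .dup (ih ha)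
  | @cons b p q h ih =>
    rcases q with _ | ⟨c, q⟩
    · obtain rfl : b = a := by simpa using ha
      cases h
      exact .dup (.cons .nil)
    · exact .cons (ih (by simpa using ha))

theorem repeats_reverse_des (l : List V) : Repeats l (des l).reverse := by
  induction l using List.reverseRecOn with
  | nil => exact .nil
  | append_singleton l a ih =>
    rw [des_concat]
    rcases h : des l with _ | ⟨b, m⟩
    · rw [h] at ih; exact ih.concat a
    · rw [h] at ih
      by_cases hb : b = a
      · subst hb
        simp only [push, if_true]
        exact ih.concat_dup (by simp)
      · simp only [push, hb, if_false]
        rw [List.reverse_cons (a := a)]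
        exact ih.concat a

theorem Repeats.head?_eq {p q : List V} (h : Repeats p q) : p.head? = q.head? := by
  cases h <;> rfl

theorem Repeats.getLast?_eq {p q : List V} (h : Repeats p q) : p.getLast? = q.getLast? := by
  induction h with
  | nil => rfl
  | dup _ ih => rw [List.getLast?_cons_cons, ih]
  | @cons a p q h ih => simp [List.getLast?_cons, ih]

theorem Repeats.isChain {R : V → V → Prop} {p q : List V} (h : Repeats p q) (hp : p.IsChain R) :
    q.IsChain R := by
  induction h with
  | nil => exact hp
  | dup _ ih => exact ih hp.tail
  | @cons a p q h ih =>
    have := h.head?_eq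
    rcases q with _ | ⟨b, q⟩
    · simp
    · rcases p with _ | ⟨c, p⟩
      · simp at this
      · obtain rfl : c = b := by simpa using this
        have hp' := List.isChain_cons_cons.1 hp
        exact List.isChain_cons_cons.2 ⟨hp'.1, ih hp'.2⟩

end Lists

/-! ### Homotopy invariance of reduced walks -/

namespace TopoPath

variable {V : Type*} {G : SimpleGraph V} {x y z : V}

theorem IsReparam.repeats {p q : TopoPath G x y} (h : p.IsReparam q) : Repeats p.nodes q.nodes :=
  let ⟨φ, hm, hs, hg⟩ := h
  .of_map φ hm hs hg

theorem TimeHomotopic.des_eq {p q : TopoPath G x y} (h : p.TimeHomotopic q) :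
    des p.nodes = des q.nodes :=
  h.elim (fun h => h.repeats.des_eq) fun h => h.repeats.des_eq.symm

/-- After the step to `a` the list is reduced with head `a`. A further step to `a` leaves it
unchanged, and a detour to `b` and back is undone by `step_step`. -/
theorem Extends.dev_eq {p q : TopoPath G x y} (h : p.Extends q) : dev p.nodes = dev q.nodes := by
  obtain ⟨l, r, a, hp, hq⟩ := h
  have key : dev (l ++ [a]) = step a (dev l) := dev_concat l a
  have h1 : (step a (dev l)).head? = some a := head?_step a _
  have h2 : Reduced (step a (dev l)) := (reduced_dev l).step a
  rcases hq with hq | ⟨b, hq⟩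
  · rw [hp, hq, dev_append, dev_append]
    simp only [List.foldl_cons, step_eq_self h1]
  · rw [hp, hq, dev_append, dev_append]
    simp only [List.foldl_cons, step_step h2 h1]

theorem Homotopic.dev_eq {p q : TopoPath G x y} (h : p.Homotopic q) :
    dev p.nodes = dev q.nodes := by
  induction h with
  | refl => rfl
  | tail _ h ih => exact ih.trans (h.elim (fun h => h.dev_eq) fun h => h.dev_eq.symm)

/-- A pattern `a, b, a` in the walk without repetitions would be a rollback with `f₂ = (a, b)`. This
`f₂` is not constant, because consecutive entries of `des` are distinct. -/
theorem NoRollback.reduced_des {p : TopoPath G x y} (h : p.NoRollback) :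
    Reduced (des p.nodes) := by
  by_contra hr
  obtain ⟨s, a, b, t, e⟩ := exists_of_not_reduced hr
  have hrep := repeats_reverse_des p.nodes
  have hch := hrep.isChain p.chain
  have hne := isChain_ne_des p.nodes
  have hhd := hrep.head?_eq
  have hlast := hrep.getLast?_eq
  rw [p.head_eq] at hhd
  rw [p.last_eq] at hlast
  have e' : (des p.nodes).reverse = (t.reverse ++ [a]) ++ b :: a :: s.reverse := by simp [e]
  rw [e'] at hrep hch hhd hlast
  rw [e] at hne
  have hab : a ≠ b := by
    have := (List.isChain_append.1 hne).2.1
    exact (List.isChain_cons_cons.1 this).1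
  have hba := (List.isChain_append.1 hch).2.2 a (by simp) b (by simp)
  refine h ⟨a, b, ⟨t.reverse ++ [a], (List.isChain_append.1 hch).1, ?_, by simp⟩,
    ⟨[a, b], by simpa using hba, rfl, rfl⟩,
    ⟨a :: s.reverse, (List.isChain_append.1 hch).2.1.tail, rfl, ?_⟩, ?_, Or.inl ?_⟩
  · rw [hhd]; cases t.reverse <;> simp
  · rw [hlast, List.getLast?_append, List.getLast?_cons_cons]; simp [List.getLast?_cons]
  · intro hc
    exact hab (hc b (by simp)).symm
  · refine hrep.exists_map.elim fun φ hφ => ?_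
    have e2 : (t.reverse ++ [a]) ++ b :: a :: s.reverse =
      (t.reverse ++ [a] ++ [a, b].tail ++ [a, b].reverse.tail) ++ (a :: s.reverse).tail := by simp
    rw [e2] at hrep
    exact hrep.exists_map

end TopoPath

end ConvexDissection

namespace ConvexDissection

/-! ### Homotopy classes coded by walks through convex cells -/

section Codes

variable {E : Type*} [NormedAddCommGroup E] [NormedSpace ℝ E] {Y : Set E}

open Path

/-- A star convex set is contractible, hence simply connected; the inclusion carries the homotopy
into `Y`. -/
theorem homotopic_of_starConvex {S : Set E} {p : E} (hS : StarConvex ℝ p S) (hSY : S ⊆ Y)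
    {x y : Y} (γ γ' : Path x y) (h : ∀ t, (γ t : E) ∈ S) (h' : ∀ t, (γ' t : E) ∈ S) :
    γ.Homotopic γ' := by
  have hx : (x : E) ∈ S := by simpa using h 0
  have hy : (y : E) ∈ S := by simpa using h 1
  have := hS.contractibleSpace ⟨_, hx⟩
  let lift (δ : Path x y) (hδ : ∀ t, (δ t : E) ∈ S) : Path (⟨x, hx⟩ : S) ⟨y, hy⟩ :=
    ⟨⟨fun t => ⟨δ t, hδ t⟩, by fun_prop⟩, by ext; simp, by ext; simp⟩
  have hc := SimplyConnectedSpace.paths_homotopic (lift γ h) (lift γ' h')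
  exact hc.map ⟨Set.inclusion hSY, continuous_inclusion hSY⟩

/-- The homotopy class contains a path that runs in the set `c`. -/
def InCell (c : Set E) {x y : Y} (κ : Homotopic.Quotient x y) : Prop :=
  ∃ γ : Path x y, (∀ t, (γ t : E) ∈ c) ∧ Homotopic.Quotient.mk γ = κ

namespace InCell

variable {c d : Set E} {x y z : Y} {κ κ' : Homotopic.Quotient x y}

omit [NormedSpace ℝ E] in
theorem left_mem (h : InCell c κ) : (x : E) ∈ c := by
  obtain ⟨γ, hγ, -⟩ := h
  simpa using hγ 0

omit [NormedSpace ℝ E] in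
theorem right_mem (h : InCell c κ) : (y : E) ∈ c := by
  obtain ⟨γ, hγ, -⟩ := h
  simpa using hγ 1

theorem eq (hc : Convex ℝ c) (hcY : c ⊆ Y) (h : InCell c κ) (h' : InCell c κ') : κ = κ' := by
  have hx := h.left_mem
  obtain ⟨γ, hγ, rfl⟩ := h
  obtain ⟨γ', hγ', rfl⟩ := h'
  exact Homotopic.Quotient.eq.2 (homotopic_of_starConvex (hc.starConvex hx) hcY γ γ' hγ hγ')

omit [NormedSpace ℝ E] in
theorem mono (hcd : c ⊆ d) (h : InCell c κ) : InCell d κ :=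
  let ⟨γ, hγ, e⟩ := h
  ⟨γ, fun t => hcd (hγ t), e⟩

omit [NormedSpace ℝ E] in
theorem refl (hx : (x : E) ∈ c) : InCell c (Homotopic.Quotient.refl x) :=
  ⟨Path.refl x, fun _ => hx, rfl⟩

omit [NormedSpace ℝ E] in
theorem symm (h : InCell c κ) : InCell c κ.symm := by
  obtain ⟨γ, hγ, rfl⟩ := h
  exact ⟨γ.symm, fun t => hγ _, rfl⟩

omit [NormedSpace ℝ E] in
theorem trans {κ₂ : Homotopic.Quotient y z} (h : InCell c κ) (h₂ : InCell c κ₂) :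
    InCell c (κ.trans κ₂) := by
  obtain ⟨γ, hγ, rfl⟩ := h
  obtain ⟨γ₂, hγ₂, rfl⟩ := h₂
  refine ⟨γ.trans γ₂, fun t => ?_, rfl⟩
  rw [Path.trans_apply]
  split_ifs
  exacts [hγ _, hγ₂ _]

end InCell

/-- The straight path between two points of a convex subset of `Y`. -/
noncomputable def segmentPath {c : Set E} (hc : Convex ℝ c) (hcY : c ⊆ Y) {x y : Y}
    (hx : (x : E) ∈ c) (hy : (y : E) ∈ c) : Path x y where
  toFun t := ⟨AffineMap.lineMap (x : E) (y : E) (t : ℝ),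
    hcY (hc.segment_subset hx hy (by
      rw [segment_eq_image_lineMap]; exact ⟨t, t.2, rfl⟩))⟩
  continuous_toFun := by
    refine Continuous.subtype_mk ?_ _
    exact AffineMap.lineMap_continuous.comp continuous_subtype_val
  source' := by ext; simp
  target' := by ext; simp

theorem segmentPath_mem {c : Set E} (hc : Convex ℝ c) (hcY : c ⊆ Y) {x y : Y}
    (hx : (x : E) ∈ c) (hy : (y : E) ∈ c) (t : I) : (segmentPath hc hcY hx hy t : E) ∈ c :=
  hc.segment_subset hx hy (by
      rw [segment_eq_image_lineMap]; exact ⟨t, t.2, rfl⟩)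

theorem exists_inCell {c : Set E} (hc : Convex ℝ c) (hcY : c ⊆ Y) {x y : Y}
    (hx : (x : E) ∈ c) (hy : (y : E) ∈ c) : ∃ κ : Homotopic.Quotient x y, InCell c κ :=
  ⟨Homotopic.Quotient.mk (segmentPath hc hcY hx hy), _, segmentPath_mem hc hcY hx hy, rfl⟩

/-- Paths in `d` with given ends form a single class, and the segment between the ends represents it
inside `c ∩ d`. This is what lets a piece of a path be transferred from one cell to a neighbouring
one. -/
theorem InCell.of_mem {c d : Set E} (hc : Convex ℝ c) (hd : Convex ℝ d) (hdY : d ⊆ Y) {x y : Y}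
    {κ : Homotopic.Quotient x y} (h : InCell d κ) (hx : (x : E) ∈ c) (hy : (y : E) ∈ c) :
    InCell c κ := by
  obtain ⟨κ', h'⟩ := exists_inCell (hc.inter hd) (inter_subset_right.trans hdY)
    ⟨hx, h.left_mem⟩ ⟨hy, h.right_mem⟩
  rw [h.eq hd hdY (h'.mono inter_subset_right)]
  exact h'.mono inter_subset_left

variable {ι : Type*} (cell : ι → Set E)

/-- The homotopy class contains a path that passes through the cells of the list, in this order. -/
def Codes : List ι → ∀ {x y : Y}, Homotopic.Quotient x y → Prop
  | [], x, _, κ => ∃ h, κ = (Homotopic.Quotient.refl x).cast rfl h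
  | a :: l, x, y, κ => ∃ (z : Y) (κ₁ : Homotopic.Quotient x z) (κ₂ : Homotopic.Quotient z y),
    InCell (cell a) κ₁ ∧ Codes l κ₂ ∧ κ = κ₁.trans κ₂

variable {cell} {x y z : Y} {l m : List ι} {a b c : ι}

omit [NormedSpace ℝ E] in
theorem codes_refl (x : Y) : Codes cell [] (Homotopic.Quotient.refl x) := ⟨rfl, by simp⟩

omit [NormedSpace ℝ E] in
theorem codes_append {κ : Homotopic.Quotient x y} : Codes cell (l ++ m) κ ↔
    ∃ (z : Y) (κ₁ : Homotopic.Quotient x z) (κ₂ : Homotopic.Quotient z y),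
      Codes cell l κ₁ ∧ Codes cell m κ₂ ∧ κ = κ₁.trans κ₂ := by
  induction l generalizing x with
  | nil =>
    constructor
    · exact fun h => ⟨x, _, κ, codes_refl x, h, by simp⟩
    · rintro ⟨z, κ₁, κ₂, ⟨rfl, rfl⟩, h, rfl⟩
      simpa using h
  | cons a l ih =>
    constructor
    · rintro ⟨z, κ₁, κ₂, h₁, h₂, rfl⟩
      obtain ⟨w, κ₃, κ₄, h₃, h₄, rfl⟩ := ih.1 h₂
      exact ⟨w, κ₁.trans κ₃, κ₄, ⟨z, κ₁, κ₃, h₁, h₃, rfl⟩, h₄, by simp⟩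
    · rintro ⟨w, κ₁, κ₂, ⟨z, κ₃, κ₄, h₃, h₄, rfl⟩, h₂, rfl⟩
      exact ⟨z, κ₃, κ₄.trans κ₂, h₃, ih.2 ⟨w, κ₄, κ₂, h₄, h₂, rfl⟩, by simp⟩

omit [NormedSpace ℝ E] in
theorem codes_singleton {κ : Homotopic.Quotient x y} : Codes cell [a] κ ↔ InCell (cell a) κ := by
  constructor
  · rintro ⟨z, κ₁, κ₂, h, ⟨rfl, rfl⟩, rfl⟩
    simpa using h
  · exact fun h => ⟨y, κ, _, h, codes_refl y, by simp⟩

omit [NormedSpace ℝ E] in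
theorem codes_concat {κ : Homotopic.Quotient x y} : Codes cell (l ++ [a]) κ ↔
    ∃ (z : Y) (κ₁ : Homotopic.Quotient x z) (κ₂ : Homotopic.Quotient z y),
      Codes cell l κ₁ ∧ InCell (cell a) κ₂ ∧ κ = κ₁.trans κ₂ := by
  simp only [codes_append, codes_singleton]

omit [NormedSpace ℝ E] in
theorem Codes.append {κ₁ : Homotopic.Quotient x y} {κ₂ : Homotopic.Quotient y z}
    (h₁ : Codes cell l κ₁) (h₂ : Codes cell m κ₂) : Codes cell (l ++ m) (κ₁.trans κ₂) :=
  codes_append.2 ⟨y, κ₁, κ₂, h₁, h₂, rfl⟩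

omit [NormedSpace ℝ E] in
theorem Codes.concat {κ₁ : Homotopic.Quotient x y} {κ₂ : Homotopic.Quotient y z}
    (h₁ : Codes cell l κ₁) (h₂ : InCell (cell a) κ₂) : Codes cell (l ++ [a]) (κ₁.trans κ₂) :=
  codes_concat.2 ⟨y, κ₁, κ₂, h₁, h₂, rfl⟩

omit [NormedSpace ℝ E] in
theorem Codes.last_mem {κ : Homotopic.Quotient x y} (h : Codes cell (l ++ [a]) κ) :
    (y : E) ∈ cell a := by
  obtain ⟨z, κ₁, κ₂, -, h₂, -⟩ := codes_concat.1 h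
  exact h₂.right_mem

omit [NormedSpace ℝ E] in
/-- A walk can be prolonged within its last cell. -/
theorem Codes.trans_inCell {κ₁ : Homotopic.Quotient x y} {κ₂ : Homotopic.Quotient y z}
    (h₁ : Codes cell (l ++ [a]) κ₁) (h₂ : InCell (cell a) κ₂) :
    Codes cell (l ++ [a]) (κ₁.trans κ₂) := by
  obtain ⟨w, κ₃, κ₄, h₃, h₄, rfl⟩ := codes_concat.1 h₁
  exact codes_concat.2 ⟨w, κ₃, κ₄.trans κ₂, h₃, h₄.trans h₂, by simp⟩

section

variable (hconv : ∀ i, Convex ℝ (cell i)) (hsub : ∀ i, cell i ⊆ Y)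
include hconv hsub

theorem Codes.step {L : List ι} {κ₁ : Homotopic.Quotient x y} {κ₂ : Homotopic.Quotient y z}
    (h₁ : Codes cell L.reverse κ₁) (h₂ : InCell (cell c) κ₂) :
    Codes cell (step c L).reverse (κ₁.trans κ₂) := by
  rcases L with _ | ⟨a, _ | ⟨b, l⟩⟩
  · exact h₁.concat h₂
  · by_cases h : a = c
    · subst h
      simpa [ConvexDissection.step] using Codes.trans_inCell (l := []) h₁ h₂
    · simpa [ConvexDissection.step, h] using h₁.concat h₂
  · by_cases hac : a = c
    · subst hac
      simp only [ConvexDissection.step, if_true]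
      rw [List.reverse_cons] at h₁ ⊢
      exact h₁.trans_inCell h₂
    · by_cases hbc : b = c
      · subst hbc
        simp only [ConvexDissection.step, hac, if_true, if_false]
        rw [List.reverse_cons] at h₁
        obtain ⟨w, κ₃, κ₄, h₃, h₄, rfl⟩ := codes_concat.1 h₁
        rw [List.reverse_cons] at h₃ ⊢
        rw [Homotopic.Quotient.trans_assoc]
        refine h₃.trans_inCell (InCell.trans ?_ h₂)
        -- The excursion into `a` begins and ends at points of `b`, so it can be pushed into `b` and
        -- absorbed.
        exact h₄.of_mem (hconv _) (hconv _) (hsub _) h₃.last_mem h₂.left_mem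
      · simp only [ConvexDissection.step, hac, hbc, if_false]
        rw [List.reverse_cons]
        exact h₁.concat h₂

theorem Codes.dev {κ : Homotopic.Quotient x y} (h : Codes cell l κ) :
    Codes cell (dev l).reverse κ := by
  induction l using List.reverseRecOn generalizing y with
  | nil => exact h
  | append_singleton l a ih =>
    obtain ⟨z, κ₁, κ₂, h₁, h₂, rfl⟩ := codes_concat.1 h
    rw [dev_concat]
    exact (ih h₁).step hconv hsub h₂

/-- A walk determines the homotopy class. -/
theorem Codes.eq {κ κ' : Homotopic.Quotient x y} (h : Codes cell l κ)
    (h' : Codes cell l κ') : κ = κ' := by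
  induction l using List.reverseRecOn generalizing y with
  | nil =>
    obtain ⟨rfl, rfl⟩ := h
    obtain ⟨-, rfl⟩ := h'
    rfl
  | append_singleton l a ih =>
    obtain ⟨z, κ₁, κ₂, h₁, h₂, rfl⟩ := codes_concat.1 h
    obtain ⟨z', κ₁', κ₂', h₁', h₂', rfl⟩ := codes_concat.1 h'
    rcases List.eq_nil_or_concat' l with rfl | ⟨m, b, rfl⟩
    · obtain ⟨rfl, rfl⟩ := h₁
      obtain ⟨rfl, rfl⟩ := h₁'
      rw [h₂.eq (hconv a) (hsub a) h₂']
    -- Both crossing points lie in the cells `a` and `b`. The segment between them prolongs the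
    -- first walk within `b`, and also belongs to `a`, where it is absorbed by the last piece.
    · obtain ⟨δ, hδ⟩ := exists_inCell (hconv b) (hsub b) h₁.last_mem h₁'.last_mem
      have hδ' := hδ.of_mem (hconv a) (hconv b) (hsub b) h₂.left_mem h₂'.left_mem
      rw [← ih (h₁.trans_inCell hδ) h₁', Homotopic.Quotient.trans_assoc,
        (hδ'.trans h₂').eq (hconv a) (hsub a) h₂]

/-- If a walk leads to the cell `a` along `κ` and can be continued to a walk along `κ * κ'`, then
the continuation is a walk along `κ'`. -/
theorem Codes.cancel_left {r : List ι} {κ : Homotopic.Quotient x y} {κ' : Homotopic.Quotient y z}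
    (h : Codes cell (l ++ [a]) κ) (h' : Codes cell (l ++ a :: r) (κ.trans κ')) :
    Codes cell (a :: r) κ' := by
  obtain ⟨w, α, β, hα, ⟨v, β₁, β₂, h₁, h₂, rfl⟩, e⟩ := codes_append.1 h'
  obtain ⟨δ, hδ⟩ := exists_inCell (hconv a) (hsub a) h.last_mem h₁.right_mem
  have e' := (h.trans_inCell hδ).eq hconv hsub (hα.concat h₁)
  -- The walk `l ++ [a]` determines its class, so `κ * δ = α * β₁`; cancelling `κ` in the
  -- fundamental groupoid leaves `δ * β₂`.
  have : κ' = δ.trans β₂ := by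
    rw [← Homotopic.Quotient.trans_assoc, ← e', Homotopic.Quotient.trans_assoc] at e
    have := congrArg (fun η => κ.symm.trans η) e
    simpa [← Homotopic.Quotient.trans_assoc] using this
  rw [this]
  exact ⟨v, δ, β₂, hδ, h₂, rfl⟩

end

omit [NormedSpace ℝ E] in
theorem codes_cast {x' y' : Y} {κ : Homotopic.Quotient x y} (hx : x' = x) (hy : y' = y) :
    Codes cell l (κ.cast hx hy) ↔ Codes cell l κ := by
  subst hx hy
  simp

omit [NormedSpace ℝ E] in
theorem mk_subpath_trans (f : Path x y) (s t u : I) :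
    (Homotopic.Quotient.mk (f.subpath s t)).trans (Homotopic.Quotient.mk (f.subpath t u)) =
      Homotopic.Quotient.mk (f.subpath s u) :=
  Homotopic.Quotient.eq.2 ⟨Path.Homotopy.subpathTransSubpath f s t u⟩

omit [NormedSpace ℝ E] in
theorem inCell_subpath {c : Set E} (f : Path x y) {s t : I} (hst : s ≤ t)
    (h : ∀ r ∈ Set.Icc s t, (f r : E) ∈ c) : InCell c (Homotopic.Quotient.mk (f.subpath s t)) := by
  refine ⟨_, fun r => ?_, rfl⟩
  have : f.subpath s t r ∈ f '' Set.Icc s t := by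
    rw [← Path.range_subpath_of_le _ _ _ hst]
    exact mem_range_self r
  obtain ⟨q, hq, e⟩ := this
  rw [← e]
  exact h q hq

omit [NormedSpace ℝ E] in
theorem codes_of_partition (f : Path x y) : ∀ (l : List ι) (t : Fin (l.length + 1) → I),
    Monotone t → (∀ k : Fin l.length, ∀ s ∈ Set.Icc (t k.castSucc) (t k.succ),
      (f s : E) ∈ cell (l.get k)) →
    Codes cell l (Homotopic.Quotient.mk (f.subpath (t 0) (t (Fin.last _))))
  | [], t, _, _ => by
    change Codes cell [] (Homotopic.Quotient.mk (f.subpath (t 0) (t 0)))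
    rw [Path.subpath_self]
    exact codes_refl _
  | a :: l, t, ht, h => by
    refine ⟨f (t 1), .mk (f.subpath (t 0) (t 1)), .mk (f.subpath (t 1) _), ?_,
      codes_of_partition f l (fun k => t k.succ) (fun i j hij => ht (Fin.succ_le_succ_iff.2 hij))
        (fun k s hs => h k.succ s hs), (mk_subpath_trans f _ _ _).symm⟩
    exact inCell_subpath f (ht (Fin.zero_le _)) (h (0 : Fin (l.length + 1)))

omit [NormedSpace ℝ E] in
theorem mk_subpath_zero_one (f : Path x y) :
    Homotopic.Quotient.mk (f.subpath 0 1) = (Homotopic.Quotient.mk f).cast f.source f.target := by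
  rw [Path.subpath_zero_one]; rfl

end Codes

namespace ConvexDivision

variable {X : PolygonalRegion} {ι : Type*} (D : ConvexDivision X ι)

theorem convex_cell (i : ι) : Convex ℝ (D.cell i) := by
  obtain ⟨V, hV⟩ := D.cell_polygon i
  rw [hV]
  exact convex_convexHull ℝ _

theorem cell_subset (i : ι) : D.cell i ⊆ X.carrier := by
  rw [← D.iUnion_cell]
  exact subset_iUnion _ i

theorem isClosed_cell (i : ι) : IsClosed (D.cell i) := by
  obtain ⟨V, hV⟩ := D.cell_polygon i
  rw [hV]
  exact V.finite_toSet.isClosed_convexHull ℝ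

theorem exists_mem_cell {p : Plane} (hp : p ∈ X.carrier) : ∃ i, p ∈ D.cell i := by
  rw [← D.iUnion_cell] at hp
  exact mem_iUnion.1 hp

variable {D}

theorem IsCode.codes {x₀ x₁ : X.carrier} {i j : ι} {f : Path x₀ x₁} {u : TopoPath D.graph i j}
    (h : D.IsCode f u) : Codes D.cell u.nodes (Path.Homotopic.Quotient.mk f) := by
  obtain ⟨t, ht, h0, h1, h⟩ := h
  have := codes_of_partition (cell := D.cell) f u.nodes t ht h
  rw [h0, h1, mk_subpath_zero_one, codes_cast] at this
  exact this

theorem IsReducedCode.codes {x₀ x₁ : X.carrier} {i j : ι} {f : Path x₀ x₁}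
    {r : TopoPath D.graph i j} (h : D.IsReducedCode f r) :
    Codes D.cell (dev r.nodes).reverse (Path.Homotopic.Quotient.mk f) := by
  obtain ⟨-, f', u, hf, hu, hr⟩ := h
  rw [Path.Homotopic.Quotient.eq.2 hf, ← hr.dev_eq]
  exact hu.codes.dev D.convex_cell D.cell_subset

end ConvexDivision

end ConvexDissection

/-! ### Sectors in the plane and regions bounded locally by two rays -/

namespace ConvexDissection

open Filter Topology

/-- The determinant of two plane vectors. -/
def det (x y : Plane) : ℝ := x 0 * y 1 - x 1 * y 0

theorem det_add_right (x y z : Plane) : det x (y + z) = det x y + det x z := by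
  simp only [det, PiLp.add_apply]; ring

theorem det_add_left (x y z : Plane) : det (x + y) z = det x z + det y z := by
  simp only [det, PiLp.add_apply]; ring

theorem det_smul_right (c : ℝ) (x y : Plane) : det x (c • y) = c * det x y := by
  simp only [det, PiLp.smul_apply, smul_eq_mul]; ring

theorem det_smul_left (c : ℝ) (x y : Plane) : det (c • x) y = c * det x y := by
  simp only [det, PiLp.smul_apply, smul_eq_mul]; ring

theorem det_self (x : Plane) : det x x = 0 := by
  simp only [det]; ring

theorem det_swap (x y : Plane) : det y x = -det x y := by
  simp only [det]; ring

theorem det_sub_right (x y z : Plane) : det x (y - z) = det x y - det x z := by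
  simp only [det, PiLp.sub_apply]; ring

theorem det_sub_left (x y z : Plane) : det (x - y) z = det x z - det y z := by
  simp only [det, PiLp.sub_apply]; ring

theorem sq_add_sq_pos {x : Plane} (hx : x ≠ 0) : 0 < x 0 ^ 2 + x 1 ^ 2 := by
  by_contra h
  apply hx
  have h0 : x 0 = 0 := by nlinarith [sq_nonneg (x 0), sq_nonneg (x 1)]
  have h1 : x 1 = 0 := by nlinarith [sq_nonneg (x 0), sq_nonneg (x 1)]
  ext i
  fin_cases i
  exacts [h0, h1]

theorem exists_smul_of_det_eq_zero {u x : Plane} (hu : u ≠ 0) (h : det u x = 0) :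
    ∃ k : ℝ, x = k • u := by
  have h2 := (sq_add_sq_pos hu).ne'
  refine ⟨(u 0 * x 0 + u 1 * x 1) / (u 0 ^ 2 + u 1 ^ 2), ?_⟩
  simp only [det] at h
  ext i
  fin_cases i
  · simp only [Fin.zero_eta, PiLp.smul_apply, smul_eq_mul]
    field_simp
    linear_combination (-u 1) * h
  · simp only [Fin.mk_one, PiLp.smul_apply, smul_eq_mul]
    field_simp
    linear_combination (u 0) * h

theorem exists_det_pos {u : Plane} (hu : u ≠ 0) : ∃ w, 0 < det u w := by
  refine ⟨!₂[-u 1, u 0], ?_⟩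
  have := sq_add_sq_pos hu
  simp [det]
  nlinarith

theorem exists_eq_mul_det (f : Plane →ₗ[ℝ] ℝ) {d : Plane} (hd : d ≠ 0) (h : f d = 0) :
    ∃ c : ℝ, ∀ x, f x = c * det d x := by
  obtain ⟨w, hw⟩ := exists_det_pos hd
  refine ⟨f w / det d w, fun x => ?_⟩
  have : det d (x - (det d x / det d w) • w) = 0 := by
    rw [det_sub_right, det_smul_right]
    field_simp
    ring
  obtain ⟨k, hk⟩ := exists_smul_of_det_eq_zero hd this
  have e : x = k • d + (det d x / det d w) • w := by rw [← hk]; abel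
  have := congrArg f e
  rw [map_add, map_smul, map_smul, h] at this
  rw [this]
  simp only [smul_eq_mul]
  ring

theorem sameRay_or_of_det_eq_zero {u v : Plane} (hu : u ≠ 0) (hv : v ≠ 0) (h : det u v = 0)
    (huv : ¬ SameRay ℝ u v) : ∃ k : ℝ, 0 < k ∧ v = -(k • u) := by
  obtain ⟨k, rfl⟩ := exists_smul_of_det_eq_zero hu h
  refine ⟨-k, ?_, by simp⟩
  by_contra hk
  exact huv (SameRay.sameRay_nonneg_smul_right u (by linarith))

/-- The union of the two rays from `p` in the directions `u` and `v`. -/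
def twoRays (p u v : Plane) : Set Plane :=
  {x | ∃ t : ℝ, 0 ≤ t ∧ (x = p + t • u ∨ x = p + t • v)}

theorem twoRays_comm (p u v : Plane) : twoRays p u v = twoRays p v u := by
  simp only [twoRays, or_comm]

/-- The open sector at `p` between the directions `u` and `v`. -/
def sector (p u v : Plane) : Set Plane := {x | 0 < det u (x - p) ∧ 0 < det (x - p) v}

/-- The open sector at `p` outside of the directions `u` and `v`. -/
def cosector (p u v : Plane) : Set Plane := {x | det u (x - p) < 0 ∨ det (x - p) v < 0}

/-- Outside both open sectors one of the two determinants vanishes, so the point is on the line of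
`u` or of `v`. If it is on the wrong half of this line, the signs force `u` and `v` to be opposite,
and then this half is the other ray. -/
theorem mem_sector_or_cosector_or_twoRays {p u v : Plane} (hu : u ≠ 0) (hv : v ≠ 0)
    (huv : ¬ SameRay ℝ u v) (h0 : 0 ≤ det u v) (x : Plane) :
    x ∈ sector p u v ∨ x ∈ cosector p u v ∨ x ∈ twoRays p u v := by
  by_cases h1 : x ∈ sector p u v
  · exact .inl h1
  by_cases h2 : x ∈ cosector p u v
  · exact .inr (.inl h2)
  refine .inr (.inr ?_)
  simp only [cosector, mem_ofPred_eq, not_or, not_lt] at h2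
  simp only [sector, mem_ofPred_eq, not_and_or, not_lt] at h1
  have hx : x = p + (x - p) := by abel
  rcases h1 with h1 | h1
  · obtain ⟨k, hk⟩ := exists_smul_of_det_eq_zero hu (le_antisymm h1 h2.1)
    rw [hk] at hx h2
    by_cases hk0 : 0 ≤ k
    · exact ⟨k, hk0, .inl hx⟩
    · rw [det_smul_left] at h2
      have : det u v = 0 := by nlinarith [h2.2]
      obtain ⟨c, hc, e⟩ := sameRay_or_of_det_eq_zero hu hv this huv
      refine ⟨-k / c, div_nonneg (by linarith) hc.le, .inr ?_⟩
      rw [hx, e, smul_neg, smul_smul, div_mul_cancel₀ _ hc.ne', neg_smul, neg_neg]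
  · have h1' : det v (x - p) = 0 := by rw [det_swap]; linarith [h2.2]
    obtain ⟨k, hk⟩ := exists_smul_of_det_eq_zero hv h1'
    rw [hk] at hx h2
    by_cases hk0 : 0 ≤ k
    · exact ⟨k, hk0, .inr hx⟩
    · rw [det_smul_right] at h2
      have : det u v = 0 := by nlinarith [h2.1]
      obtain ⟨c, hc, e⟩ := sameRay_or_of_det_eq_zero hu hv this huv
      refine ⟨-(k * c), by nlinarith, .inl ?_⟩
      rw [hx, e, smul_neg, smul_smul, neg_smul]

/-- For an angle below `π` the sum `u + v` works; for opposite directions, any vector to the left of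
`u`. -/
theorem exists_sector_direction {u v : Plane} (hu : u ≠ 0) (hv : v ≠ 0)
    (huv : ¬ SameRay ℝ u v) (h0 : 0 ≤ det u v) : ∃ e, 0 < det u e ∧ 0 < det e v := by
  rcases h0.lt_or_eq with h | h
  · refine ⟨u + v, ?_, ?_⟩
    · rwa [det_add_right, det_self, zero_add]
    · rwa [det_add_left, det_self, add_zero]
  · obtain ⟨c, hc, rfl⟩ := sameRay_or_of_det_eq_zero hu hv h.symm huv
    obtain ⟨w, hw⟩ := exists_det_pos hu
    refine ⟨w, hw, ?_⟩
    rw [← neg_smul, det_smul_right, det_swap]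
    nlinarith

theorem twoRays_add_mem_sector {p u v e x : Plane} (h0 : 0 ≤ det u v) (h1 : 0 < det u e)
    (h2 : 0 < det e v) (hx : x ∈ twoRays p u v) {s : ℝ} (hs : 0 < s) :
    x + s • e ∈ sector p u v := by
  obtain ⟨t, ht, rfl | rfl⟩ := hx
  · have : p + t • u + s • e - p = t • u + s • e := by abel
    simp only [sector, mem_ofPred_eq, this, det_add_right, det_add_left, det_smul_left,
      det_smul_right, det_self]
    constructor <;> nlinarith [mul_pos hs h1, mul_pos hs h2, mul_nonneg ht h0]
  · have : p + t • v + s • e - p = t • v + s • e := by abel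
    simp only [sector, mem_ofPred_eq, this, det_add_right, det_add_left, det_smul_left,
      det_smul_right, det_self]
    constructor <;> nlinarith [mul_pos hs h1, mul_pos hs h2, mul_nonneg ht h0]

theorem twoRays_sub_mem_cosector {p u v e x : Plane} (h1 : 0 < det u e)
    (h2 : 0 < det e v) (hx : x ∈ twoRays p u v) {s : ℝ} (hs : 0 < s) :
    x - s • e ∈ cosector p u v := by
  obtain ⟨t, ht, rfl | rfl⟩ := hx
  · have : p + t • u - s • e - p = t • u - s • e := by abel
    left
    simp only [this, det_sub_right, det_smul_right, det_self]
    nlinarith [mul_pos hs h1]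
  · have : p + t • v - s • e - p = t • v - s • e := by abel
    right
    simp only [this, det_sub_left, det_smul_left, det_self]
    nlinarith [mul_pos hs h2]

theorem convex_det_right_lt (u p : Plane) : Convex ℝ {x | det u (x - p) < 0} := by
  intro x hx y hy a b ha hb hab
  simp only [mem_ofPred_eq] at *
  have : a • x + b • y - p = a • (x - p) + b • (y - p) := by
    rw [smul_sub, smul_sub, sub_add_sub_comm, ← add_smul, hab, one_smul]
  rw [this, det_add_right, det_smul_right, det_smul_right]
  rcases ha.lt_or_eq with h | rfl
  · nlinarith [mul_neg_of_pos_of_neg h hx, mul_nonneg hb (neg_nonneg.2 hy.le)]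
  · obtain rfl : b = 1 := by linarith
    linarith

theorem convex_det_left_lt (v p : Plane) : Convex ℝ {x | det (x - p) v < 0} := by
  have := convex_det_right_lt (-v) p
  have e : ∀ x : Plane, det (-v) (x - p) = det (x - p) v := fun x => by
    rw [det_swap, ← neg_one_smul ℝ v, det_smul_right]; ring
  simpa only [e] using this

theorem convex_sector (p u v : Plane) : Convex ℝ (sector p u v) := by
  have h1 := (convex_det_right_lt (-u) p).inter (convex_det_left_lt (-v) p)
  convert h1 using 1
  ext x
  simp only [sector, mem_ofPred_eq, mem_inter_iff, ← neg_one_smul ℝ v, ← neg_one_smul ℝ u,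
    det_smul_left, det_smul_right]
  constructor <;> rintro ⟨h, h'⟩ <;> constructor <;> linarith

theorem eventually_add_smul_mem {U : Set Plane} (hU : IsOpen U) {x : Plane} (hx : x ∈ U)
    (e : Plane) : ∀ᶠ s : ℝ in 𝓝[>] 0, x + s • e ∈ U := by
  have : Tendsto (fun s : ℝ => x + s • e) (𝓝 0) (𝓝 (x + (0 : ℝ) • e)) :=
    Continuous.tendsto (by fun_prop) 0
  rw [zero_smul, add_zero] at this
  exact (this.mono_left nhdsWithin_le_nhds) (hU.mem_nhds hx)

theorem eventually_sub_smul_mem {U : Set Plane} (hU : IsOpen U) {x : Plane} (hx : x ∈ U)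
    (e : Plane) : ∀ᶠ s : ℝ in 𝓝[>] 0, x - s • e ∈ U := by
  filter_upwards [eventually_add_smul_mem hU hx (-e)] with s hs
  rwa [smul_neg, ← sub_eq_add_neg] at hs

theorem eventually_pos : ∀ᶠ s : ℝ in 𝓝[>] 0, 0 < s := self_mem_nhdsWithin

/-- The set is a union of two convex half discs that share the points `p - s • e` for small `s`. -/
theorem isPreconnected_cosector_inter_ball {p u v e : Plane} (h1 : 0 < det u e)
    (h2 : 0 < det e v) {r : ℝ} (hr : 0 < r) :
    IsPreconnected (cosector p u v ∩ Metric.ball p r) := by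
  have e1 : cosector p u v ∩ Metric.ball p r =
      ({x | det u (x - p) < 0} ∩ Metric.ball p r) ∪
        ({x | det (x - p) v < 0} ∩ Metric.ball p r) := by
    rw [← union_inter_distrib_right]; rfl
  rw [e1]
  obtain ⟨s, hs, hs'⟩ := (eventually_pos.and
    (eventually_sub_smul_mem Metric.isOpen_ball (Metric.mem_ball_self hr) e)).exists
  have e2 : p - s • e - p = (-s) • e := by rw [neg_smul]; abel
  refine IsPreconnected.union (p - s • e) ⟨?_, hs'⟩ ⟨?_, hs'⟩
    ((convex_det_right_lt u p).inter (convex_ball p r)).isPreconnected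
    ((convex_det_left_lt v p).inter (convex_ball p r)).isPreconnected
  · simp only [mem_ofPred_eq, e2, det_smul_right]; nlinarith
  · simp only [mem_ofPred_eq, e2, det_smul_left]; nlinarith

theorem self_mem_twoRays (p u v : Plane) : p ∈ twoRays p u v := ⟨0, le_rfl, .inl (by simp)⟩

theorem self_notMem_sector (p u v : Plane) : p ∉ sector p u v := by
  rintro ⟨h, -⟩
  simp [det] at h

theorem self_notMem_cosector (p u v : Plane) : p ∉ cosector p u v := by
  rintro (h | h) <;> simp [det] at h

theorem twoRays_inter_ball_subset_closure_sector {p u v e : Plane} (h0 : 0 ≤ det u v)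
    (h1 : 0 < det u e) (h2 : 0 < det e v) (r : ℝ) :
    twoRays p u v ∩ Metric.ball p r ⊆ closure (sector p u v ∩ Metric.ball p r) := by
  rintro x ⟨hx, hxr⟩
  rw [mem_closure_iff]
  intro o ho hxo
  obtain ⟨s, ⟨hs, hs1⟩, hs2⟩ := ((eventually_pos.and
    (eventually_add_smul_mem Metric.isOpen_ball hxr e)).and
    (eventually_add_smul_mem ho hxo e)).exists
  exact ⟨_, hs2, twoRays_add_mem_sector h0 h1 h2 hx hs, hs1⟩

theorem twoRays_inter_ball_subset_closure_cosector {p u v e : Plane}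
    (h1 : 0 < det u e) (h2 : 0 < det e v) (r : ℝ) :
    twoRays p u v ∩ Metric.ball p r ⊆ closure (cosector p u v ∩ Metric.ball p r) := by
  rintro x ⟨hx, hxr⟩
  rw [mem_closure_iff]
  intro o ho hxo
  obtain ⟨s, ⟨hs, hs1⟩, hs2⟩ := ((eventually_pos.and
    (eventually_sub_smul_mem Metric.isOpen_ball hxr e)).and
    (eventually_sub_smul_mem ho hxo e)).exists
  exact ⟨_, hs2, twoRays_sub_mem_cosector h1 h2 hx hs, hs1⟩

/-- Away from the frontier, the interior of `t` and the complement of its closure are two disjoint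
open sets that cover `s`. -/
theorem IsPreconnected.subset_or_disjoint_of_disjoint_frontier {α : Type*} [TopologicalSpace α]
    {s t : Set α} (hs : IsPreconnected s) (h : Disjoint s (frontier t)) : s ⊆ t ∨ Disjoint s t := by
  by_contra! hc
  obtain ⟨h1, h2⟩ := hc
  obtain ⟨x, hx, hxt⟩ := not_subset.1 h1
  obtain ⟨y, hy, hyt⟩ := not_disjoint_iff.1 h2
  have hcov : ∀ z ∈ s, z ∈ closure t → z ∈ interior t := fun z hz hzc => by
    by_contra hzi
    exact Set.disjoint_left.1 h hz ⟨hzc, hzi⟩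
  obtain ⟨z, -, hz1, hz2⟩ := hs (interior t) (closure t)ᶜ isOpen_interior
    isClosed_closure.isOpen_compl (fun z hz => (em (z ∈ closure t)).imp (hcov z hz) id)
    ⟨y, hy, hcov y hy (subset_closure hyt)⟩
    ⟨x, hx, fun hxc => hxt (interior_subset (hcov x hx hxc))⟩
  exact hz2 (interior_subset_closure hz1)

/-- A line through `p` cuts the disc into two open halves. Each half stays connected when the line
without `p` is added, since this lies in its closure, and the two enlarged halves share a point of
the line. -/
theorem isPreconnected_ball_diff_center (p : Plane) {r : ℝ} (hr : 0 < r) :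
    IsPreconnected (Metric.ball p r \ {p}) := by
  obtain ⟨u, hu⟩ : ∃ u : Plane, u ≠ 0 := exists_ne 0
  have hv : -u ≠ 0 := neg_ne_zero.2 hu
  have huv : ¬ SameRay ℝ u (-u) := fun h => hu (eq_zero_of_sameRay_self_neg h)
  have h0 : 0 ≤ det u (-u) := by rw [← neg_one_smul ℝ u, det_smul_right, det_self]; simp
  obtain ⟨e, h1, h2⟩ := exists_sector_direction hu hv huv h0
  set S := sector p u (-u)
  set T := cosector p u (-u)
  set R := twoRays p u (-u)
  set B := Metric.ball p r
  have key : B \ {p} = (S ∩ B ∪ (R ∩ B) \ {p}) ∪ (T ∩ B ∪ (R ∩ B) \ {p}) := by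
    ext x
    have := mem_sector_or_cosector_or_twoRays (p := p) hu hv huv h0 x
    have hS : x = p → x ∉ S := fun h => h ▸ self_notMem_sector p u (-u)
    have hT : x = p → x ∉ T := fun h => h ▸ self_notMem_cosector p u (-u)
    simp only [mem_union, Set.mem_sdiff, mem_inter_iff, mem_singleton_iff]
    tauto
  rw [key]
  obtain ⟨s, hs, hs'⟩ := (eventually_pos.and
    (eventually_add_smul_mem Metric.isOpen_ball (Metric.mem_ball_self hr) u)).exists
  have hmem : p + s • u ∈ (R ∩ B) \ {p} := by
    refine ⟨⟨⟨s, hs.le, .inl rfl⟩, hs'⟩, ?_⟩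
    simp [hs.ne', hu]
  refine IsPreconnected.union (p + s • u) (.inr hmem) (.inr hmem) ?_ ?_
  · refine IsPreconnected.subset_closure
      ((convex_sector p u (-u)).inter (convex_ball p r)).isPreconnected subset_union_left ?_
    exact union_subset subset_closure (sdiff_subset.trans
      (twoRays_inter_ball_subset_closure_sector h0 h1 h2 r))
  · refine IsPreconnected.subset_closure
      (isPreconnected_cosector_inter_ball h1 h2 hr) subset_union_left ?_
    exact union_subset subset_closure (sdiff_subset.trans
      (twoRays_inter_ball_subset_closure_cosector h1 h2 r))

/-- A closed set that is the closure of its interior, and whose frontier near `p` is contained in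
two rays, looks like a sector near `p`. -/
theorem local_structure_of_frontier_subset_twoRays {X : Set Plane} (hXc : IsClosed X)
    (hXi : closure (interior X) = X) {p u v : Plane} (hp : p ∈ frontier X) (hu : u ≠ 0)
    (hv : v ≠ 0) (huv : ¬ SameRay ℝ u v) {r : ℝ} (hr : 0 < r)
    (hF : Metric.ball p r ∩ frontier X ⊆ twoRays p u v) :
    IsPreconnected ((Metric.ball p r ∩ X) \ {p}) ∧
      ∃ e : Plane, ∀ᶠ s : ℝ in 𝓝[>] 0, p + s • e ∉ X := by
  wlog h0 : 0 ≤ det u v generalizing u v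
  · refine this hv hu (fun h => huv h.symm) (by rwa [twoRays_comm]) ?_
    rw [det_swap]; linarith
  obtain ⟨e, h1, h2⟩ := exists_sector_direction hu hv huv h0
  have hpX : p ∈ X := hXc.frontier_subset hp
  have hcov := mem_sector_or_cosector_or_twoRays (p := p) hu hv huv h0
  set S := sector p u v with hS
  set T := cosector p u v with hT
  set R := twoRays p u v with hR
  set B := Metric.ball p r with hB
  have hSB : IsPreconnected (S ∩ B) :=
    ((convex_sector p u v).inter (convex_ball p r)).isPreconnected
  have hTB : IsPreconnected (T ∩ B) := isPreconnected_cosector_inter_ball h1 h2 hr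
  have hpS : p ∉ S := self_notMem_sector p u v
  have hpT : p ∉ T := self_notMem_cosector p u v
  have hRS : R ∩ B ⊆ closure (S ∩ B) := twoRays_inter_ball_subset_closure_sector h0 h1 h2 r
  have hRT : R ∩ B ⊆ closure (T ∩ B) := twoRays_inter_ball_subset_closure_cosector h1 h2 r
  have hdisj : ∀ x, x ∈ R → x ∉ S ∧ x ∉ T := by
    rintro x ⟨t, ht, rfl | rfl⟩ <;>
      simp only [hS, hT, sector, cosector, mem_ofPred_eq, add_sub_cancel_left, det_smul_left,
        det_smul_right, det_self, mul_zero, lt_irrefl, false_and, and_false, not_false_eq_true,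
        true_and, false_or, or_false, not_lt]
    · positivity
    · positivity
  have hSF : Disjoint (S ∩ B) (frontier X) := by
    rw [Set.disjoint_left]
    exact fun x hx hxF => (hdisj x (hF ⟨hx.2, hxF⟩)).1 hx.1
  have hTF : Disjoint (T ∩ B) (frontier X) := by
    rw [Set.disjoint_left]
    exact fun x hx hxF => (hdisj x (hF ⟨hx.2, hxF⟩)).2 hx.1
  have hpB : p ∈ B := Metric.mem_ball_self hr
  have hdir1 : ∀ᶠ s : ℝ in 𝓝[>] 0, p + s • e ∈ S ∩ B := by
    filter_upwards [eventually_pos, eventually_add_smul_mem Metric.isOpen_ball hpB e] with s hs hs'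
    exact ⟨twoRays_add_mem_sector h0 h1 h2 (self_mem_twoRays p u v) hs, hs'⟩
  have hdir2 : ∀ᶠ s : ℝ in 𝓝[>] 0, p + s • -e ∈ T ∩ B := by
    filter_upwards [eventually_pos, eventually_sub_smul_mem Metric.isOpen_ball hpB e] with s hs hs'
    rw [smul_neg, ← sub_eq_add_neg]
    exact ⟨twoRays_sub_mem_cosector h1 h2 (self_mem_twoRays p u v) hs, hs'⟩
  rcases IsPreconnected.subset_or_disjoint_of_disjoint_frontier hSB hSF with hS1 | hS1 <;>
    rcases IsPreconnected.subset_or_disjoint_of_disjoint_frontier hTB hTF with hT1 | hT1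
  -- If both sectors lie in `X`, so do the rays, and `p` would be an interior point.
  · exfalso
    have hBX : B ⊆ X := by
      intro x hx
      rcases hcov x with h | h | h
      · exact hS1 ⟨h, hx⟩
      · exact hT1 ⟨h, hx⟩
      · exact hXc.closure_subset_iff.2 hS1 (hRS ⟨h, hx⟩)
    exact hp.2 (mem_interior.2 ⟨B, hBX, Metric.isOpen_ball, hpB⟩)
  · refine ⟨hSB.subset_closure ?_ ?_, -e, ?_⟩
    · exact fun x hx => ⟨⟨hx.2, hS1 hx⟩, fun h => hpS (h ▸ hx.1)⟩
    · rintro x ⟨⟨hxB, hxX⟩, -⟩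
      rcases hcov x with h | h | h
      · exact subset_closure ⟨h, hxB⟩
      · exact absurd hxX (Set.disjoint_left.1 hT1 ⟨h, hxB⟩)
      · exact hRS ⟨h, hxB⟩
    · exact hdir2.mono fun s hs => Set.disjoint_left.1 hT1 hs
  · refine ⟨hTB.subset_closure ?_ ?_, e, ?_⟩
    · exact fun x hx => ⟨⟨hx.2, hT1 hx⟩, fun h => hpT (h ▸ hx.1)⟩
    · rintro x ⟨⟨hxB, hxX⟩, -⟩
      rcases hcov x with h | h | h
      · exact absurd hxX (Set.disjoint_left.1 hS1 ⟨h, hxB⟩)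
      · exact subset_closure ⟨h, hxB⟩
      · exact hRT ⟨h, hxB⟩
    · exact hdir1.mono fun s hs => Set.disjoint_left.1 hS1 hs
  -- If `X` misses both sectors, its interior near `p` would be contained in the two rays, but every
  -- point of these is a limit of points of a sector.
  · exfalso
    have hpc : p ∈ closure (interior X) := hXi.symm ▸ hpX
    obtain ⟨x, hxB, hxX⟩ := mem_closure_iff.1 hpc B Metric.isOpen_ball hpB
    rcases hcov x with h | h | h
    · exact Set.disjoint_left.1 hS1 ⟨h, hxB⟩ (interior_subset hxX)
    · exact Set.disjoint_left.1 hT1 ⟨h, hxB⟩ (interior_subset hxX)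
    · obtain ⟨y, hy, hyS⟩ := mem_closure_iff.1 (hRS ⟨h, hxB⟩) _ isOpen_interior hxX
      exact Set.disjoint_left.1 hS1 hyS (interior_subset hy)

end ConvexDissection

/-! ### Local structure of the region and of the cells at a point -/

namespace ConvexDissection

open Filter Topology

/-- A finite union of closed sets is near `p` the union of those which contain `p`. -/
theorem exists_ball_forall_mem {κ : Type*} [Finite κ] {C : κ → Set Plane}
    (hC : ∀ k, IsClosed (C k)) (p : Plane) :
    ∃ r > 0, ∀ k, ∀ x ∈ Metric.ball p r, x ∈ C k → p ∈ C k := by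
  have : ∀ᶠ x in 𝓝 p, ∀ k, x ∈ C k → p ∈ C k := by
    refine eventually_all.2 fun k => ?_
    by_cases h : p ∈ C k
    · exact Eventually.of_forall fun _ _ => h
    · filter_upwards [(hC k).isOpen_compl.mem_nhds h] with x hx hx'
      exact absurd hx' hx
  obtain ⟨r, hr, h⟩ := Metric.eventually_nhds_iff_ball.1 this
  exact ⟨r, hr, fun k x hx => h x hx k⟩

theorem isClosed_edgeSet {n : ℕ} (P : Polygon Plane n) (i : Fin n) :
    IsClosed (P.edgeSet ℝ i) := by
  rw [Polygon.edgeSet_eq_image_edgePath]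
  exact (isCompact_Icc.image (P.edgePath ℝ i).continuous_of_finiteDimensional).isClosed

theorem left_mem_edgeSet {n : ℕ} (P : Polygon Plane n) (i : Fin n) :
    P.vertices i ∈ P.edgeSet ℝ i := left_mem_affineSegment ℝ _ _

theorem right_mem_edgeSet {n : ℕ} (P : Polygon Plane n) (i : Fin n) :
    P.vertices (finRotate n i) ∈ P.edgeSet ℝ i := right_mem_affineSegment ℝ _ _

theorem finRotate_ne {n : ℕ} (hn : 2 ≤ n) (i : Fin n) : finRotate n i ≠ i := by
  obtain ⟨m, rfl⟩ : ∃ m, n = m + 2 := ⟨n - 2, by omega⟩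
  rw [finRotate_apply]
  simp

namespace IsSimplePolygon

variable {n : ℕ} {P : Polygon Plane n} (h : IsSimplePolygon P)
include h

theorem eq_or_eq_of_vertex_mem {i j : Fin n} (hj : P.vertices (finRotate n i) ∈ P.edgeSet ℝ j) :
    j = i ∨ j = finRotate n i := by
  by_contra! hc
  have hi : P.vertices (finRotate n i) ∈ P.edgeSet ℝ i := right_mem_edgeSet P i
  by_cases hij : i = finRotate n j
  · have : P.vertices (finRotate n i) ∈ ({P.vertices (finRotate n j)} : Set Plane) := by
      rw [← h.inter_next j, ← hij]
      exact ⟨hj, hi⟩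
    have e := h.injective (mem_singleton_iff.1 this)
    rw [← hij] at e
    exact finRotate_ne (by have := h.three_le; omega) i e
  · exact Set.disjoint_left.1 (h.disjoint i j hc.1 hc.2 hij) hi hj

theorem eq_of_mem {p : Plane} (hp : p ∉ range P.vertices) {i j : Fin n}
    (hi : p ∈ P.edgeSet ℝ i) (hj : p ∈ P.edgeSet ℝ j) : j = i := by
  by_contra hc
  by_cases h1 : j = finRotate n i
  · have : p ∈ ({P.vertices (finRotate n i)} : Set Plane) := by
      rw [← h.inter_next i, ← h1]; exact ⟨hi, hj⟩
    exact hp ⟨_, (mem_singleton_iff.1 this).symm⟩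
  · by_cases h2 : i = finRotate n j
    · have : p ∈ ({P.vertices (finRotate n j)} : Set Plane) := by
        rw [← h.inter_next j, ← h2]; exact ⟨hj, hi⟩
      exact hp ⟨_, (mem_singleton_iff.1 this).symm⟩
    · exact Set.disjoint_left.1 (h.disjoint i j hc h1 h2) hi hj

theorem vertices_ne (i : Fin n) : P.vertices i ≠ P.vertices (finRotate n i) := fun e =>
  finRotate_ne (by have := h.three_le; omega) i (h.injective e).symm

/-- The edges through a point of a simple polygon lie on two rays. -/
theorem exists_twoRays {p : Plane} (hp : p ∈ P.boundary ℝ) :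
    ∃ u v : Plane, u ≠ 0 ∧ v ≠ 0 ∧ ¬ SameRay ℝ u v ∧
      ∀ j, p ∈ P.edgeSet ℝ j → P.edgeSet ℝ j ⊆ twoRays p u v := by
  by_cases hv : p ∈ range P.vertices
  · obtain ⟨k, rfl⟩ := hv
    obtain ⟨i, rfl⟩ := (finRotate n).surjective k
    set p := P.vertices (finRotate n i) with hpdef
    set a := P.vertices i with ha
    set b := P.vertices (finRotate n (finRotate n i)) with hb
    have hu : a - p ≠ 0 := sub_ne_zero.2 (h.vertices_ne i)
    have hw : b - p ≠ 0 := sub_ne_zero.2 (h.vertices_ne (finRotate n i)).symm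
    refine ⟨a - p, b - p, hu, hw, fun hs => ?_, fun j hj => ?_⟩
    · obtain ⟨c, d, hc, hd, e⟩ := hs.exists_pos hu hw
      -- Division by the larger coefficient brings both into the interval from `0` to `1`, which
      -- gives a point other than `p` on both edges.
      set m := max c d with hm
      have hm0 : 0 < m := lt_max_of_lt_left hc
      have h1 : p + (c / m) • (a - p) ∈ P.edgeSet ℝ i := by
        rw [Polygon.edgeSet, affineSegment_comm]
        refine ⟨c / m, ⟨by positivity, div_le_one_of_le₀ (le_max_left _ _) hm0.le⟩, ?_⟩
        rw [AffineMap.lineMap_apply]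
        simp [add_comm, ha, hpdef]
      have h2 : p + (c / m) • (a - p) ∈ P.edgeSet ℝ (finRotate n i) := by
        refine ⟨d / m, ⟨by positivity, div_le_one_of_le₀ (le_max_right _ _) hm0.le⟩, ?_⟩
        have e' : (c / m) • (a - p) = (d / m) • (b - p) := by
          rw [div_eq_inv_mul, div_eq_inv_mul, mul_smul, mul_smul, e]
        rw [AffineMap.lineMap_apply, e']
        simp [add_comm, hb, hpdef]
      have h3 : p + (c / m) • (a - p) ∈ ({P.vertices (finRotate n i)} : Set Plane) := by
        rw [← h.inter_next i]; exact ⟨h1, h2⟩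
      have h4 : (c / m) • (a - p) = 0 := by
        have := mem_singleton_iff.1 h3
        rw [← hpdef] at this
        simpa using this
      rcases smul_eq_zero.1 h4 with h5 | h5
      · exact (by positivity : c / m ≠ 0) h5
      · exact hu h5
    · rcases h.eq_or_eq_of_vertex_mem hj with rfl | rfl
      · rintro x hx
        rw [Polygon.edgeSet, affineSegment_comm] at hx
        obtain ⟨t, ht, rfl⟩ := hx
        refine ⟨t, ht.1, .inl ?_⟩
        rw [AffineMap.lineMap_apply]
        simp [add_comm, ha, hpdef]
      · rintro x ⟨t, ht, rfl⟩
        refine ⟨t, ht.1, .inr ?_⟩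
        rw [AffineMap.lineMap_apply]
        simp [add_comm, hb, hpdef]
  · obtain ⟨i, hi⟩ := mem_iUnion.1 hp
    set a := P.vertices i with ha
    set b := P.vertices (finRotate n i) with hb
    have hab : b - a ≠ 0 := sub_ne_zero.2 (h.vertices_ne i).symm
    obtain ⟨t, ht, rfl⟩ := id hi
    have ht0 : 0 < t := by
      refine lt_of_le_of_ne ht.1 fun e => hv ⟨i, ?_⟩
      rw [← e]; simp
    have ht1 : t < 1 := by
      refine lt_of_le_of_ne ht.2 fun e => hv ⟨finRotate n i, ?_⟩
      rw [e]; simp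
    refine ⟨a - b, b - a, sub_ne_zero.2 (h.vertices_ne i), hab, fun hs => ?_, fun j hj => ?_⟩
    · rw [← neg_sub b a] at hs
      exact hab (eq_zero_of_sameRay_self_neg hs.symm)
    · obtain rfl := h.eq_of_mem hv hi hj
      rintro x ⟨s, hs, rfl⟩
      simp only [AffineMap.lineMap_apply, vsub_eq_sub, vadd_eq_add]
      rcases le_total s t with hst | hst
      · refine ⟨t - s, by linarith, .inl ?_⟩
        simp only [← ha, ← hb]
        module
      · refine ⟨s - t, by linarith, .inr ?_⟩
        simp only [← ha, ← hb]
        module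

end IsSimplePolygon

namespace PolygonalRegion

variable (X : PolygonalRegion)

theorem vertexSet_subset_frontier : X.vertexSet ⊆ frontier X.carrier := by
  rw [X.frontier_eq]
  refine iUnion_mono fun k => ?_
  rintro _ ⟨i, rfl⟩
  exact mem_iUnion.2 ⟨i, left_mem_edgeSet _ i⟩

/-- A small disc meets only those boundary edges that contain `p`. They belong to one boundary
polygon, as these are disjoint, and hence lie on two rays. -/
theorem local_structure {p : Plane} (hp : p ∈ frontier X.carrier) :
    ∃ e : Plane, (∀ᶠ s : ℝ in 𝓝[>] 0, p + s • e ∉ X.carrier) ∧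
      ∃ r₀ > 0, ∀ r, 0 < r → r ≤ r₀ →
        IsPreconnected ((Metric.ball p r ∩ X.carrier) \ {p}) := by
  have hp' := hp
  rw [X.frontier_eq] at hp'
  obtain ⟨k, hk⟩ := mem_iUnion.1 hp'
  obtain ⟨u, v, hu, hv, huv, hedge⟩ := (X.loop_simple k).exists_twoRays hk
  obtain ⟨r₀, hr₀, hball⟩ := exists_ball_forall_mem
    (C := fun q : Σ k, Fin (X.sides k) => (X.loop q.1).edgeSet ℝ q.2)
    (fun q => isClosed_edgeSet _ _) p
  have key : ∀ r, r ≤ r₀ → Metric.ball p r ∩ frontier X.carrier ⊆ twoRays p u v := by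
    rintro r hr x ⟨hxr, hxF⟩
    rw [X.frontier_eq] at hxF
    obtain ⟨l, hl⟩ := mem_iUnion.1 hxF
    obtain ⟨j, hj⟩ := mem_iUnion.1 hl
    have hpj := hball ⟨l, j⟩ x (Metric.ball_subset_ball hr hxr) hj
    obtain rfl : l = k := by
      by_contra hlk
      exact Set.disjoint_left.1 (X.loop_disjoint l k hlk) (mem_iUnion.2 ⟨j, hpj⟩) hk
    exact hedge j hpj hj
  have hloc := fun r hr hr' => local_structure_of_frontier_subset_twoRays X.isCompact.isClosed
    X.closure_interior hp hu hv huv (r := r) hr (key r hr')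
  obtain ⟨-, e, he⟩ := hloc r₀ hr₀ le_rfl
  exact ⟨e, he, r₀, hr₀, fun r hr hr' => (hloc r hr hr').1⟩

/-- A point of the region has arbitrarily small neighbourhoods in the region which remain connected
when the point is removed. -/
theorem exists_ball_preconnected {p : Plane} (hp : p ∈ X.carrier) :
    ∃ r₀ > 0, ∀ r, 0 < r → r ≤ r₀ → IsPreconnected ((Metric.ball p r ∩ X.carrier) \ {p}) := by
  by_cases h : p ∈ frontier X.carrier
  · exact (X.local_structure h).elim fun e he => he.2
  · have hpi : p ∈ interior X.carrier := by
      by_contra hpi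
      exact h ⟨subset_closure hp, hpi⟩
    obtain ⟨r₀, hr₀, hb⟩ := Metric.isOpen_iff.1 isOpen_interior p hpi
    refine ⟨r₀, hr₀, fun r hr hr' => ?_⟩
    rw [inter_eq_self_of_subset_left
      ((Metric.ball_subset_ball hr').trans (hb.trans interior_subset))]
    exact isPreconnected_ball_diff_center p hr

end PolygonalRegion

namespace ConvexDivision

variable {X : PolygonalRegion} {ι : Type*} (D : ConvexDivision X ι)

theorem closure_interior_cell (i : ι) : closure (interior (D.cell i)) = D.cell i := by
  rw [(D.convex_cell i).closure_interior_eq_closure_of_nonempty_interior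
    (D.cell_interior_nonempty i), (D.isClosed_cell i).closure_eq]

/-- The cells at a point are connected through cutlines at this point. -/
theorem reflTransGen_adj_of_mem [Finite ι] {p : Plane} {a b : ι} (ha : p ∈ D.cell a)
    (hb : p ∈ D.cell b) :
    Relation.ReflTransGen (fun c d => D.graph.Adj c d ∧ p ∈ D.cell c ∧ p ∈ D.cell d) a b := by
  obtain ⟨r₁, hr₁, h1⟩ := X.exists_ball_preconnected (D.cell_subset a ha)
  obtain ⟨r₂, hr₂, h2⟩ := exists_ball_forall_mem D.isClosed_cell p
  set r := min r₁ r₂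
  have hr : 0 < r := lt_min hr₁ hr₂
  have hpre := h1 r hr (min_le_left _ _)
  set R := Relation.ReflTransGen (fun c d => D.graph.Adj c d ∧ p ∈ D.cell c ∧ p ∈ D.cell d) a
  by_contra hab
  have hclosed : ∀ Q : ι → Prop, IsClosed (⋃ c : {c // Q c}, D.cell c) := fun Q =>
    isClosed_iUnion_of_finite fun c => D.isClosed_cell c
  -- A cell is the closure of its interior, so it has points other than `p` in every disc around
  -- `p`.
  have hmeet : ∀ c, p ∈ D.cell c →
      (((Metric.ball p r ∩ X.carrier) \ {p}) ∩ D.cell c).Nonempty := by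
    intro c hc
    have hcc := hc
    rw [← D.closure_interior_cell c] at hcc
    obtain ⟨y, hyr, hyc⟩ := mem_closure_iff.1 hcc _ Metric.isOpen_ball (Metric.mem_ball_self hr)
    obtain ⟨w, hw⟩ := exists_ne (0 : Plane)
    by_cases hyp : y = p
    · obtain ⟨s, hs, hs'⟩ := (eventually_pos.and (eventually_add_smul_mem
        (Metric.isOpen_ball.inter isOpen_interior) ⟨hyr, hyc⟩ w)).exists
      refine ⟨y + s • w, ⟨⟨hs'.1, D.cell_subset c (interior_subset hs'.2)⟩, ?_⟩,
        interior_subset hs'.2⟩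
      rw [mem_singleton_iff, hyp]
      simp [hs.ne', hw]
    · exact ⟨y, ⟨⟨hyr, D.cell_subset c (interior_subset hyc)⟩, hyp⟩, interior_subset hyc⟩
  -- The cells reachable from `a` and the unreachable ones give two closed sets that cover the
  -- connected punctured disc, so they have a common point `x ≠ p`. With `p` it makes a
  -- nondegenerate cutline, and an unreachable cell becomes reachable.
  obtain ⟨x, ⟨⟨hxr, -⟩, hxp⟩, hx1, hx2⟩ := isPreconnected_closed_iff.1 hpre
    (⋃ c : {c // R c ∧ p ∈ D.cell c}, D.cell c) (⋃ c : {c // ¬ R c ∧ p ∈ D.cell c}, D.cell c)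
    (hclosed _) (hclosed _)
    (by
      rintro x ⟨⟨hxr, hxX⟩, -⟩
      obtain ⟨c, hc⟩ := D.exists_mem_cell hxX
      have hpc := h2 c x (Metric.ball_subset_ball (min_le_right _ _) hxr) hc
      by_cases hRc : R c
      · exact .inl (mem_iUnion.2 ⟨⟨c, hRc, hpc⟩, hc⟩)
      · exact .inr (mem_iUnion.2 ⟨⟨c, hRc, hpc⟩, hc⟩))
    (by
      obtain ⟨x, hx, hxa⟩ := hmeet a ha
      exact ⟨x, hx, mem_iUnion.2 ⟨⟨a, .refl, ha⟩, hxa⟩⟩)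
    (by
      obtain ⟨x, hx, hxb⟩ := hmeet b hb
      exact ⟨x, hx, mem_iUnion.2 ⟨⟨b, hab, hb⟩, hxb⟩⟩)
  obtain ⟨⟨c, hRc, hpc⟩, hxc⟩ := mem_iUnion.1 hx1
  obtain ⟨⟨d, hRd, hpd⟩, hxd⟩ := mem_iUnion.1 hx2
  refine hRd (Relation.ReflTransGen.tail hRc ⟨⟨?_, x, ⟨hxc, hxd⟩, p, ⟨hpc, hpd⟩, hxp⟩, hpc, hpd⟩)
  rintro rfl
  exact hRd hRc

/-- At most two cells meet at an interior point. -/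
theorem not_three_cells_of_mem_interior {p : Plane} (hp : p ∈ interior X.carrier) {a b c : ι}
    (hab : a ≠ b) (hac : a ≠ c) (hbc : b ≠ c) (ha : p ∈ D.cell a) (hb : p ∈ D.cell b)
    (hc : p ∈ D.cell c) : False := by
  -- The interiors are separated by a line; it passes through `p`, since `p` lies in both cells.
  have hsep : ∀ i j, i ≠ j → p ∈ D.cell i → p ∈ D.cell j → ∃ f : Plane →ₗ[ℝ] ℝ,
      (∀ x ∈ interior (D.cell i), f x < f p) ∧ (∀ x ∈ interior (D.cell j), f p < f x) ∧
      (∀ x ∈ D.cell i, f x ≤ f p) ∧ ∀ x ∈ D.cell j, f p ≤ f x := by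
    intro i j hij hi hj
    obtain ⟨f, u, h1, h2⟩ := geometric_hahn_banach_open_open (D.convex_cell i).interior
      isOpen_interior (D.convex_cell j).interior isOpen_interior (D.cell_interior_disjoint i j hij)
    have h1' : ∀ x ∈ D.cell i, f x ≤ u := by
      rw [← D.closure_interior_cell i]
      exact fun x hx => closure_minimal (fun y hy => (h1 y hy).le)
        (isClosed_le f.continuous continuous_const) hx
    have h2' : ∀ x ∈ D.cell j, u ≤ f x := by
      rw [← D.closure_interior_cell j]
      exact fun x hx => closure_minimal (fun y hy => (h2 y hy).le)
        (isClosed_le continuous_const f.continuous) hx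
    obtain rfl : u = f p := le_antisymm (h2' p hj) (h1' p hi)
    exact ⟨f, h1, h2, h1', h2'⟩
  -- Vertices of cells lie on the frontier, so `p` is not extreme. Some segment of the cell has `p`
  -- in its relative interior, and a linear form extremal at `p` is constant along it.
  have hseg : ∀ i, p ∈ D.cell i → ∃ d : Plane, d ≠ 0 ∧ ∀ f : Plane →ₗ[ℝ] ℝ,
      ((∀ x ∈ D.cell i, f x ≤ f p) ∨ ∀ x ∈ D.cell i, f p ≤ f x) → f d = 0 := by
    intro i hi
    have hne : p ∉ (D.cell i).extremePoints ℝ := fun h =>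
      (X.vertexSet_subset_frontier (D.no_new_vertices i h)).2 hp
    rw [mem_extremePoints] at hne
    push Not at hne
    obtain ⟨x, hx, y, hy, hpxy, hne⟩ := hne hi
    obtain ⟨s, t, hs, ht, hst, rfl⟩ := id hpxy
    have hxy : x - y ≠ 0 := by
      intro e
      obtain rfl := sub_eq_zero.1 e
      rw [← add_smul, hst, one_smul] at hne
      exact hne rfl rfl
    refine ⟨x - y, hxy, fun f hf => ?_⟩
    obtain rfl : t = 1 - s := by linarith
    simp only [map_add, map_smul, smul_eq_mul, map_sub] at hf ⊢
    rcases hf with hf | hf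
    · have h1 := hf x hx
      have h2 := hf y hy
      nlinarith
    · have h1 := hf x hx
      have h2 := hf y hy
      nlinarith
  obtain ⟨f, f1, f2, f3, f4⟩ := hsep a b hab ha hb
  obtain ⟨g, g1, g2, g3, g4⟩ := hsep a c hac ha hc
  obtain ⟨k, k1, k2, k3, k4⟩ := hsep b c hbc hb hc
  obtain ⟨d, hd, hd'⟩ := hseg a ha
  obtain ⟨d', hd0', hd''⟩ := hseg b hb
  obtain ⟨α, hα⟩ := exists_eq_mul_det f hd (hd' f (.inl f3))
  obtain ⟨β, hβ⟩ := exists_eq_mul_det g hd (hd' g (.inl g3))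
  obtain ⟨x, hx⟩ := D.cell_interior_nonempty a
  obtain ⟨y, hy⟩ := D.cell_interior_nonempty b
  obtain ⟨z, hz⟩ := D.cell_interior_nonempty c
  have fx := f1 x hx
  have fy := f2 y hy
  have gx := g1 x hx
  have gz := g2 z hz
  have ky := k1 y hy
  have kz := k2 z hz
  have hα0 : α ≠ 0 := by
    rintro rfl
    rw [hα, hα] at fx
    linarith
  -- The form `f` is nonzero and vanishes on both directions, so they are parallel. All three
  -- separating forms are then multiples of `det d`.
  have hdd : det d d' = 0 := by
    have := hd'' f (.inr f4)
    rw [hα] at this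
    exact (mul_eq_zero.1 this).resolve_left hα0
  obtain ⟨m, hm⟩ := exists_smul_of_det_eq_zero hd hdd
  have hm0 : m ≠ 0 := by
    rintro rfl
    exact hd0' (by simpa using hm)
  have hkd : k d = 0 := by
    have := hd'' k (.inl k3)
    rw [hm, map_smul, smul_eq_mul] at this
    exact (mul_eq_zero.1 this).resolve_left hm0
  obtain ⟨γ, hγ⟩ := exists_eq_mul_det k hd hkd
  rw [hα, hα] at fx fy
  rw [hβ, hβ] at gx gz
  rw [hγ, hγ] at ky kz
  set P := det d p
  set A := det d x
  set B := det d y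
  set C := det d z
  have e1 : α * (A - P) < 0 := by linarith
  have e2 : 0 < α * (B - P) := by linarith
  have e3 : β * (A - P) < 0 := by linarith
  have e4 : 0 < β * (C - P) := by linarith
  have e5 : γ * (B - P) < 0 := by linarith
  have e6 : 0 < γ * (C - P) := by linarith
  -- The three cells would lie pairwise on opposite sides of a single line, which has only two
  -- sides.
  rcases mul_neg_iff.1 e1 with ⟨h1, h2⟩ | ⟨h1, h2⟩ <;>
    rcases mul_neg_iff.1 e3 with ⟨h3, h4⟩ | ⟨h3, h4⟩ <;>
    rcases mul_neg_iff.1 e5 with ⟨h5, h6⟩ | ⟨h5, h6⟩ <;>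
    rcases mul_pos_iff.1 e2 with ⟨h7, h8⟩ | ⟨h7, h8⟩ <;>
    rcases mul_pos_iff.1 e4 with ⟨h9, h10⟩ | ⟨h9, h10⟩ <;>
    rcases mul_pos_iff.1 e6 with ⟨h11, h12⟩ | ⟨h11, h12⟩ <;> linarith

end ConvexDivision

end ConvexDissection

/-! ### Angular order and the forest of cells at a point -/

namespace ConvexDissection

open Filter Topology

/-- The angle at `p`, with a jump along the ray in the direction `e`. -/
theorem exists_angle (p : Plane) {e : Plane} (he : e ≠ 0) : ∃ θ : Plane → ℝ,
    (∀ x, (∀ k : ℝ, 0 ≤ k → x - p ≠ k • e) → ContinuousAt θ x) ∧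
      ∀ x y, x ≠ p → y ≠ p → θ x = θ y → ∃ k : ℝ, 0 < k ∧ y - p = k • (x - p) := by
  let L : Plane ≃ₗᵢ[ℝ] ℂ := Complex.orthonormalBasisOneI.repr.symm
  have hLe : L (-e) ≠ 0 := by simpa using he
  -- Division by the image of `-e` turns the branch cut of `arg` into the ray in the direction `e`.
  refine ⟨fun x => Complex.arg (L (x - p) / L (-e)), fun x hx => ?_, fun x y hx hy hxy => ?_⟩
  · have hslit : L (x - p) / L (-e) ∈ Complex.slitPlane := by
      by_contra h
      rw [Complex.mem_slitPlane_iff, not_or, not_lt, not_not] at h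
      refine hx (-(L (x - p) / L (-e)).re) (by linarith [h.1]) ?_
      have h1 : L (x - p) / L (-e) = ((L (x - p) / L (-e)).re : ℂ) :=
        Complex.ext rfl (by simpa using h.2)
      set c := (L (x - p) / L (-e)).re
      apply L.injective
      rw [div_eq_iff hLe] at h1
      rw [h1, map_smul, map_neg, Complex.real_smul]
      push_cast
      ring
    exact ContinuousAt.comp (f := fun x => L (x - p) / L (-e)) (Complex.continuousAt_arg hslit)
      (by fun_prop)
  · have h1 : L (x - p) / L (-e) ≠ 0 := div_ne_zero (by simpa [sub_eq_zero] using hx) hLe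
    have h2 : L (y - p) / L (-e) ≠ 0 := div_ne_zero (by simpa [sub_eq_zero] using hy) hLe
    have h3 := (Complex.arg_eq_arg_iff h1 h2).1 hxy
    refine ⟨‖L (y - p) / L (-e)‖ / ‖L (x - p) / L (-e)‖,
      div_pos (norm_pos_iff.2 h2) (norm_pos_iff.2 h1), ?_⟩
    apply L.injective
    rw [map_smul, Complex.real_smul]
    field_simp at h3
    push_cast
    field_simp
    linear_combination -h3

namespace ConvexDivision

variable {X : PolygonalRegion} {ι : Type*} (D : ConvexDivision X ι)

/-- Some direction `e` leaves the region at `p`, so the angle with its jump along `e` is continuous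
on the cells at `p` outside `p`. The interiors of these cells have disjoint intervals of angles,
which orders them linearly. The last cell of `T` has at most one neighbour in `T`: a cell strictly
between two adjacent ones would be squeezed onto a ray. -/
theorem exists_adj_subsingleton_of_mem_frontier {p : Plane} (hp : p ∈ frontier X.carrier)
    {T : Finset ι} (hT : T.Nonempty) (hTp : ∀ a ∈ T, p ∈ D.cell a) :
    ∃ a ∈ T, ∀ b ∈ T, ∀ c ∈ T, D.graph.Adj a b → D.graph.Adj a c → b = c := by
  obtain ⟨e, he, -⟩ := X.local_structure hp
  have hpX : p ∈ X.carrier := X.isCompact.isClosed.frontier_subset hp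
  have he0 : e ≠ 0 := by
    rintro rfl
    obtain ⟨s, hs⟩ := he.exists
    simp [hpX] at hs
  obtain ⟨θ, hθc, hθ⟩ := exists_angle p he0
  -- A point of a cell on the forbidden ray would bring, by convexity, points `p + s • e` with
  -- arbitrarily small `s` into the region.
  have hcell : ∀ a, p ∈ D.cell a → ∀ x ∈ D.cell a, x ≠ p → ∀ k : ℝ, 0 ≤ k → x - p ≠ k • e := by
    intro a ha x hx hxp k hk hxk
    have hk0 : 0 < k := by
      refine lt_of_le_of_ne hk fun h => hxp ?_
      rw [← h, zero_smul, sub_eq_zero] at hxk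
      exact hxk
    have hlt : ∀ᶠ s : ℝ in 𝓝[>] 0, s < k := nhdsWithin_le_nhds (Iio_mem_nhds hk0)
    obtain ⟨s, ⟨hs, hs0⟩, hsk⟩ := ((he.and eventually_pos).and hlt).exists
    refine hs (D.cell_subset a ?_)
    have := (D.convex_cell a).add_smul_sub_mem ha hx (t := s / k)
      ⟨by positivity, (div_le_one hk0).2 hsk.le⟩
    rwa [hxk, smul_smul, div_mul_cancel₀ _ hk0.ne'] at this
  have hpint : ∀ a, p ∉ interior (D.cell a) := fun a h =>
    hp.2 (interior_mono (D.cell_subset a) h)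
  have hne : ∀ a, ∀ x ∈ interior (D.cell a), x ≠ p := fun a x hx h => hpint a (h ▸ hx)
  have hJ : ∀ a, p ∈ D.cell a → (θ '' interior (D.cell a)).OrdConnected := by
    intro a ha
    refine ((D.convex_cell a).interior.isPreconnected.image θ fun x hx => ?_).ordConnected
    exact (hθc x (hcell a ha x (interior_subset hx) (hne a x hx))).continuousWithinAt
  -- Points of equal angle lie on one ray from `p`. Contracting towards `p` keeps each in the
  -- interior of its cell, and suitable factors make the two coincide.
  have hJdisj : ∀ a b, p ∈ D.cell a → p ∈ D.cell b → a ≠ b →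
      ∀ x ∈ interior (D.cell a), ∀ y ∈ interior (D.cell b), θ x ≠ θ y := by
    intro a b ha hb hab x hx y hy hxy
    obtain ⟨k, hk, e1⟩ := hθ x y (hne a x hx) (hne b y hy) hxy
    have hmem : ∀ (c : ι), p ∈ D.cell c → ∀ z ∈ interior (D.cell c), ∀ s : ℝ, 0 < s → s ≤ 1 →
        p + s • (z - p) ∈ interior (D.cell c) := by
      intro c hc z hz s hs hs1
      have := (D.convex_cell c).combo_self_interior_mem_interior hc hz (a := 1 - s) (b := s)
        (by linarith) hs (by ring)
      convert this using 1
      module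
    set m := max k 1
    have hm : 0 < m := lt_max_of_lt_left hk
    have h1 := hmem a ha x hx (k / m) (by positivity) (div_le_one_of_le₀ (le_max_left _ _) hm.le)
    have h2 := hmem b hb y hy (1 / m) (by positivity) (div_le_one_of_le₀ (le_max_right _ _) hm.le)
    rw [e1, smul_smul, one_div_mul_eq_div] at h2
    exact Set.disjoint_left.1 (D.cell_interior_disjoint a b hab) h1 h2
  choose w hw using D.cell_interior_nonempty
  have hlt : ∀ a b, p ∈ D.cell a → p ∈ D.cell b → a ≠ b → θ (w a) ≤ θ (w b) →
      ∀ x ∈ interior (D.cell a), ∀ y ∈ interior (D.cell b), θ x < θ y := by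
    intro a b ha hb hab hle x hx y hy
    have h1 : θ (w a) < θ y := by
      by_contra! h
      obtain ⟨z, hz, e1⟩ := (hJ b hb).out (mem_image_of_mem θ hy) (mem_image_of_mem θ (hw b))
        ⟨h, hle⟩
      exact hJdisj a b ha hb hab _ (hw a) z hz e1.symm
    by_contra! h
    obtain ⟨z, hz, e1⟩ := (hJ a ha).out (mem_image_of_mem θ (hw a)) (mem_image_of_mem θ hx)
      ⟨h1.le, h⟩
    exact hJdisj a b ha hb hab z hz y hy e1
  have hbound : ∀ a, p ∈ D.cell a → ∀ q ∈ D.cell a, q ≠ p → ∀ t : ℝ,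
      ((∀ x ∈ interior (D.cell a), θ x ≤ t) → θ q ≤ t) ∧
      ((∀ x ∈ interior (D.cell a), t ≤ θ x) → t ≤ θ q) := by
    intro a ha q hq hqp t
    have hcont := hθc q (hcell a ha q hq hqp)
    have hq' : q ∈ closure (interior (D.cell a)) := by rwa [D.closure_interior_cell]
    have hcl := mem_closure_image hcont hq'
    constructor
    · intro h
      exact closure_minimal (t := Iic t) (by rintro _ ⟨x, hx, rfl⟩; exact h x hx) isClosed_Iic hcl
    · intro h
      exact closure_minimal (t := Ici t) (by rintro _ ⟨x, hx, rfl⟩; exact h x hx) isClosed_Ici hcl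
  obtain ⟨a, haT, hamax⟩ := T.exists_max_image (fun a => θ (w a)) hT
  have key : ∀ b ∈ T, ∀ c ∈ T, D.graph.Adj a b → D.graph.Adj a c → θ (w b) ≤ θ (w c) → b = c := by
    intro b hbT c hcT hab hac hbc
    by_contra hne'
    have ha := hTp a haT
    have hb := hTp b hbT
    have hc := hTp c hcT
    obtain ⟨q, ⟨hqa, hqb⟩, hqp⟩ := hab.2.exists_ne p
    -- The point `q` of the cutline bounds the angles of `c` from above as a point of `a`, and from
    -- below as a point of `b`. A constant angle is impossible on a nonempty open set.
    have heq : ∀ y ∈ interior (D.cell c), θ y = θ q := by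
      intro y hy
      refine le_antisymm ?_ ?_
      · exact (hbound a ha q hqa hqp _).2 fun x hx =>
          (hlt c a hc ha hac.1.symm (hamax c hcT) y hy x hx).le
      · exact (hbound b hb q hqb hqp _).1 fun x hx =>
          (hlt b c hb hc hne' hbc x hx y hy).le
    have hwc := hne c _ (hw c)
    obtain ⟨v, hv⟩ := exists_det_pos (sub_ne_zero.2 hwc)
    obtain ⟨s, hs, hs'⟩ :=
      (eventually_pos.and (eventually_add_smul_mem isOpen_interior (hw c) v)).exists
    obtain ⟨k, -, e1⟩ := hθ _ _ hwc (hne c _ hs') ((heq _ (hw c)).trans (heq _ hs').symm)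
    have e2 := congrArg (det (w c - p)) e1
    rw [add_sub_right_comm, det_add_right, det_smul_right, det_smul_right, det_self] at e2
    nlinarith [mul_pos hs hv]
  refine ⟨a, haT, fun b hbT c hcT hab hac => ?_⟩
  rcases le_total (θ (w b)) (θ (w c)) with h | h
  · exact key b hbT c hcT hab hac h
  · exact (key c hcT b hbT hac hab h).symm

/-- The adjacency graph of the cells at a point is a forest: every finite set of cells at the point
contains a cell with at most one neighbour in the set. -/
theorem exists_adj_subsingleton {p : Plane} {T : Finset ι} (hT : T.Nonempty)
    (hTp : ∀ a ∈ T, p ∈ D.cell a) :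
    ∃ a ∈ T, ∀ b ∈ T, ∀ c ∈ T, D.graph.Adj a b → D.graph.Adj a c → b = c := by
  obtain ⟨a, ha⟩ := id hT
  by_cases hp : p ∈ interior X.carrier
  · refine ⟨a, ha, fun b hb c hc hab hac => ?_⟩
    by_contra hbc
    exact D.not_three_cells_of_mem_interior hp hab.1 hac.1 hbc (hTp a ha) (hTp b hb) (hTp c hc)
  · exact D.exists_adj_subsingleton_of_mem_frontier
      ⟨subset_closure (D.cell_subset a (hTp a ha)), hp⟩ hT hTp

end ConvexDivision

end ConvexDissection

/-! ### The covering of the region by sheets labelled with reduced walks -/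

namespace ConvexDissection

open Filter Topology

/-- On a forest, prescribed quotients along the edges are realized by a function on the nodes. -/
theorem exists_potential {ι M : Type*} [Group M] (G : SimpleGraph ι) (e : ι → ι → M)
    (he : ∀ a b, G.Adj a b → e a b * e b a = 1) {S : Set ι}
    (hS : ∀ T : Finset ι, T.Nonempty → ↑T ⊆ S →
      ∃ a ∈ T, ∀ b ∈ T, ∀ c ∈ T, G.Adj a b → G.Adj a c → b = c) (T : Finset ι) (hT : ↑T ⊆ S) :
    ∃ ψ : ι → M, ∀ a ∈ T, ∀ b ∈ T, G.Adj a b → ψ b = e a b * ψ a := by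
  classical
  induction T using Finset.strongInduction with
  | H T ih =>
    rcases T.eq_empty_or_nonempty with rfl | hne
    · exact ⟨1, by simp⟩
    · obtain ⟨a, ha, hsub⟩ := hS T hne hT
      obtain ⟨ψ, hψ⟩ := ih (T.erase a) (Finset.erase_ssubset ha)
        ((Finset.coe_subset.2 (Finset.erase_subset a T)).trans hT)
      by_cases hb : ∃ b ∈ T, G.Adj a b
      · obtain ⟨b, hbT, hab⟩ := hb
        have key : ∀ y ∈ T, G.Adj a y → y = b := fun y hy hay => hsub y hy b hbT hay hab
        refine ⟨Function.update ψ a (e b a * ψ b), fun x hx y hy hxy => ?_⟩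
        by_cases hxa : x = a
        · subst hxa
          obtain rfl := key y hy hxy
          rw [Function.update_self, Function.update_of_ne hxy.ne', ← mul_assoc, he _ _ hxy,
            one_mul]
        · by_cases hya : y = a
          · subst hya
            obtain rfl := key x hx hxy.symm
            rw [Function.update_self, Function.update_of_ne hxa]
          · rw [Function.update_of_ne hxa, Function.update_of_ne hya]
            exact hψ x (Finset.mem_erase.2 ⟨hxa, hx⟩) y (Finset.mem_erase.2 ⟨hya, hy⟩) hxy
      · push Not at hb
        refine ⟨ψ, fun x hx y hy hxy => ?_⟩
        have hxa : x ≠ a := fun h => hb y hy (h ▸ hxy)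
        have hya : y ≠ a := fun h => hb x hx (h ▸ hxy.symm)
        exact hψ x (Finset.mem_erase.2 ⟨hxa, hx⟩) y (Finset.mem_erase.2 ⟨hya, hy⟩) hxy

/-- The reduced walks, listed backwards, with the discrete topology. -/
@[ext]
structure ReducedWalk (ι : Type*) where
  val : List ι
  property : Reduced val

namespace ReducedWalk

variable {ι : Type*}

instance : TopologicalSpace (ReducedWalk ι) := ⊥

instance : DiscreteTopology (ReducedWalk ι) := ⟨rfl⟩

/-- Move walks that end at `a` to `b`, and vice versa. -/
noncomputable def swapFun (a b : ι) (L : ReducedWalk ι) : ReducedWalk ι :=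
  open Classical in
  if L.val.head? = some a then ⟨step b L.val, L.property.step b⟩
  else if L.val.head? = some b then ⟨step a L.val, L.property.step a⟩ else L

theorem swapFun_of_head {a b : ι} {L : ReducedWalk ι} (h : L.val.head? = some a) :
    (swapFun a b L).val = step b L.val := by
  rw [swapFun, if_pos h]

theorem swapFun_of_head_right {a b : ι} (hab : a ≠ b) {L : ReducedWalk ι}
    (h : L.val.head? = some b) : (swapFun a b L).val = step a L.val := by
  have h' : L.val.head? ≠ some a := by
    rw [h]
    exact fun e => hab (Option.some.inj e).symm
  rw [swapFun, if_neg h', if_pos h]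

theorem swapFun_comm {a b : ι} (hab : a ≠ b) (L : ReducedWalk ι) :
    swapFun a b (swapFun b a L) = L := by
  apply ReducedWalk.ext
  by_cases h1 : L.val.head? = some b
  · have h2 := swapFun_of_head (b := a) h1
    rw [swapFun_of_head (a := a) (by rw [h2, head?_step]), h2, step_step L.property h1]
  · by_cases h3 : L.val.head? = some a
    · have h2 := swapFun_of_head_right hab.symm h3
      rw [swapFun_of_head_right hab (by rw [h2, head?_step]), h2, step_step L.property h3]
    · simp [swapFun, h1, h3]

open Classical in
/-- The permutation `swapFun a b`, for `a ≠ b`. -/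
noncomputable def swap (a b : ι) : Equiv.Perm (ReducedWalk ι) :=
  if hab : a = b then 1 else
    ⟨swapFun a b, swapFun b a, swapFun_comm (Ne.symm hab), swapFun_comm hab⟩

theorem swap_mul_swap (a b : ι) : swap a b * swap b a = 1 := by
  by_cases hab : a = b
  · simp [swap, hab]
  · refine Equiv.ext fun L => ?_
    rw [swap, swap, dif_neg hab, dif_neg (Ne.symm hab)]
    exact swapFun_comm hab L

theorem swap_of_head {a b : ι} (hab : a ≠ b) {L : ReducedWalk ι} (h : L.val.head? = some a) :
    (swap a b L).val = step b L.val := by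
  rw [swap, dif_neg hab]
  exact swapFun_of_head h

end ReducedWalk

namespace ConvexDivision

variable {X : PolygonalRegion} {ι : Type*} (D : ConvexDivision X ι)

/-- The points all of whose cells contain `p`. -/
def star (p : X.carrier) : Set X.carrier :=
  {q | ∀ c, (q : Plane) ∈ D.cell c → (p : Plane) ∈ D.cell c}

theorem self_mem_star (p : X.carrier) : p ∈ D.star p := fun _ h => h

/-- A cell that contains `q`. -/
noncomputable def cellAt (q : X.carrier) : ι := (D.exists_mem_cell q.2).choose

theorem mem_cellAt (q : X.carrier) : (q : Plane) ∈ D.cell (D.cellAt q) :=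
  (D.exists_mem_cell q.2).choose_spec

variable [Finite ι]

/-- The transition permutations between adjacent cells at `p` have no cycle condition to satisfy,
because these cells form a forest. The resulting potential trivializes the covering near `p`. -/
theorem exists_pot (p : X.carrier) : ∃ ψ : ι → Equiv.Perm (ReducedWalk ι),
    ∀ a b, (p : Plane) ∈ D.cell a → (p : Plane) ∈ D.cell b → D.graph.Adj a b →
      ψ b = ReducedWalk.swap a b * ψ a := by
  obtain ⟨ψ, hψ⟩ := exists_potential D.graph ReducedWalk.swap
    (fun a b _ => ReducedWalk.swap_mul_swap a b) (S := {a | (p : Plane) ∈ D.cell a})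
    (fun T hT hTS => D.exists_adj_subsingleton hT fun a ha => hTS ha)
    (Set.toFinite {a | (p : Plane) ∈ D.cell a}).toFinset (by simp)
  exact ⟨ψ, fun a b ha hb => hψ a (by simpa using ha) b (by simpa using hb)⟩

/-- Coordinates for the sheets over a neighbourhood of `p`. -/
noncomputable def pot (p : X.carrier) : ι → Equiv.Perm (ReducedWalk ι) :=
  (D.exists_pot p).choose

theorem pot_adj (p : X.carrier) {a b : ι} (ha : (p : Plane) ∈ D.cell a)
    (hb : (p : Plane) ∈ D.cell b) (hab : D.graph.Adj a b) :
    D.pot p b = ReducedWalk.swap a b * D.pot p a :=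
  (D.exists_pot p).choose_spec a b ha hb hab

theorem isOpen_star (p : X.carrier) : IsOpen (D.star p) := by
  have : D.star p = ⋂ c : ι, {q : X.carrier | (q : Plane) ∈ D.cell c → (p : Plane) ∈ D.cell c} := by
    ext q; simp [star]
  rw [this]
  refine isOpen_iInter_of_finite fun c => ?_
  by_cases h : (p : Plane) ∈ D.cell c
  · simp [h]
  · simp only [h, imp_false]
    exact ((D.isClosed_cell c).preimage continuous_subtype_val).isOpen_compl

/-- Across a cutline through `q` both potentials receive the same left factor, which cancels in the
quotient; the cells at `q` are connected by such cutlines. Hence the coordinate change does not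
depend on the chosen cell and is locally constant. -/
theorem pot_inv_mul_pot {p p' q : X.carrier} (h : q ∈ D.star p) (h' : q ∈ D.star p') {c d : ι}
    (hc : (q : Plane) ∈ D.cell c) (hd : (q : Plane) ∈ D.cell d) :
    (D.pot p' d)⁻¹ * D.pot p d = (D.pot p' c)⁻¹ * D.pot p c := by
  induction D.reflTransGen_adj_of_mem hc hd with
  | refl => rfl
  | tail _ hab ih =>
    obtain ⟨hadj, ha, hb⟩ := hab
    rw [D.pot_adj p (h _ ha) (h _ hb) hadj, D.pot_adj p' (h' _ ha) (h' _ hb) hadj, ← ih ha]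
    group

/-- The covering of the region by the cells over the nodes of the universal covering of the
topological graph. -/
noncomputable def coveringCore : FiberBundleCore X.carrier X.carrier (ReducedWalk ι) where
  baseSet := D.star
  isOpen_baseSet := D.isOpen_star
  indexAt := id
  mem_baseSet_at := D.self_mem_star
  coordChange p p' q v := ((D.pot p' (D.cellAt q))⁻¹ * D.pot p (D.cellAt q)) v
  coordChange_self p q _ v := by simp
  continuousOn_coordChange p p' := by
    rintro ⟨q, v⟩ ⟨⟨h, h'⟩, -⟩
    refine ContinuousAt.continuousWithinAt ?_
    have hev : ∀ᶠ z : X.carrier × ReducedWalk ι in 𝓝 (q, v), z.1 ∈ D.star q :=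
      continuousAt_fst.eventually ((D.isOpen_star q).mem_nhds (D.self_mem_star q))
    have hcont : Continuous fun z : X.carrier × ReducedWalk ι =>
        ((D.pot p' (D.cellAt q))⁻¹ * D.pot p (D.cellAt q)) z.2 :=
      continuous_of_discreteTopology.comp continuous_snd
    refine hcont.continuousAt.congr ?_
    filter_upwards [hev] with z hz
    rw [D.pot_inv_mul_pot h h' (D.mem_cellAt q) (hz _ (D.mem_cellAt z.1))]
  coordChange_comp p p' p'' q _ v := by simp

theorem isCoveringMap_proj : IsCoveringMap D.coveringCore.proj :=
  FiberBundle.isCoveringMap (E := D.coveringCore.Fiber)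

/-- The walk that leads to the sheet of the cell `c` through a point of the covering. -/
noncomputable def sheet (z : D.coveringCore.TotalSpace) (c : ι) : ReducedWalk ι :=
  D.pot z.1 c z.2

/-- In the trivialization around the base point of `z` the fibre coordinate is locally constant.
Independence of the cell translates this into equality of the labels. -/
theorem eventually_sheet_eq (z : D.coveringCore.TotalSpace) :
    ∀ᶠ z' in 𝓝 z, ∀ c, (z'.1 : Plane) ∈ D.cell c →
      (z.1 : Plane) ∈ D.cell c ∧ D.sheet z' c = D.sheet z c := by
  let e := D.coveringCore.localTrivAt z.1
  have hz : z ∈ e.source := D.coveringCore.mem_localTrivAt_baseSet z.1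
  have h1 : ContinuousAt (fun z' => (e z').2) z :=
    continuous_snd.continuousAt.comp (e.continuousOn.continuousAt (e.open_source.mem_nhds hz))
  have h2 : ∀ᶠ z' in 𝓝 z, (e z').2 = (e z).2 :=
    h1.eventually (mem_nhds_discrete.2 (mem_singleton _))
  filter_upwards [h2, e.open_source.mem_nhds hz] with z' h3 h4 c hc
  have h5 : z'.1 ∈ D.star z.1 := h4
  refine ⟨h5 c hc, ?_⟩
  have h6 : ((D.pot z.1 (D.cellAt z'.1))⁻¹ * D.pot z'.1 (D.cellAt z'.1)) z'.2 =
    ((D.pot z.1 (D.cellAt z.1))⁻¹ * D.pot z.1 (D.cellAt z.1)) z.2 := h3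
  rw [← D.pot_inv_mul_pot (D.self_mem_star z'.1) h5 (D.mem_cellAt z'.1) hc, inv_mul_cancel] at h6
  exact Equiv.Perm.inv_eq_iff_eq.1 (h6 : (D.pot z.1 c)⁻¹ (D.pot z'.1 c z'.2) = z.2)

theorem sheet_adj (z : D.coveringCore.TotalSpace) {a b : ι} (ha : (z.1 : Plane) ∈ D.cell a)
    (hb : (z.1 : Plane) ∈ D.cell b) (hab : D.graph.Adj a b) :
    D.sheet z b = ReducedWalk.swap a b (D.sheet z a) := by
  rw [sheet, D.pot_adj z.1 ha hb hab]; rfl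

/-- The fibre also contains lists that do not end at the cell considered. The labels that do end
there are preserved by the transitions. -/
theorem head?_sheet (z : D.coveringCore.TotalSpace) {a b : ι} (ha : (z.1 : Plane) ∈ D.cell a)
    (hb : (z.1 : Plane) ∈ D.cell b) (h : (D.sheet z a).val.head? = some a) :
    (D.sheet z b).val.head? = some b := by
  induction D.reflTransGen_adj_of_mem ha hb with
  | refl => exact h
  | tail _ hab ih =>
    obtain ⟨hadj, ha', hb'⟩ := hab
    rw [D.sheet_adj z ha' hb' hadj, ReducedWalk.swap_of_head hadj.1 (ih ha'), head?_step]

/-- A continuous choice of walks from the cell `i` to the cells that a path passes through. -/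
structure IsLift {x₀ x₁ : X.carrier} (γ : Path x₀ x₁) (i : ι) (w : I → ι → List ι) : Prop where
  zero : w 0 i = [i]
  head (t : I) {c : ι} : (γ t : Plane) ∈ D.cell c → (w t c).head? = some c
  step (t : I) {c d : ι} : (γ t : Plane) ∈ D.cell c → (γ t : Plane) ∈ D.cell d →
    D.graph.Adj c d → w t d = step d (w t c)
  eventually_eq (t : I) : ∀ᶠ s in 𝓝 t, ∀ c, (γ s : Plane) ∈ D.cell c →
    (γ t : Plane) ∈ D.cell c ∧ w s c = w t c

theorem isLift_of_lift {x₀ x₁ : X.carrier} (γ : Path x₀ x₁) {i : ι}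
    (Γ : C(I, D.coveringCore.TotalSpace)) (hΓ : ∀ t, (Γ t).1 = γ t) (hi : (x₀ : Plane) ∈ D.cell i)
    (h0 : (D.sheet (Γ 0) i).val = [i]) :
    D.IsLift γ i fun t c => (D.sheet (Γ t) c).val := by
  have hcell : ∀ t c, ((Γ t).1 : Plane) ∈ D.cell c ↔ (γ t : Plane) ∈ D.cell c := fun t c => by
    rw [hΓ]
  have hev : ∀ t, ∀ᶠ s in 𝓝 t, ∀ c, ((Γ s).1 : Plane) ∈ D.cell c →
      ((Γ t).1 : Plane) ∈ D.cell c ∧ D.sheet (Γ s) c = D.sheet (Γ t) c := fun t =>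
    (Γ.continuous.tendsto t).eventually (D.eventually_sheet_eq (Γ t))
  -- Having labels that end at the right cells is a locally constant property of time, so it is
  -- inherited from time `0`.
  have hhead : ∀ s t, (∀ c, ((Γ s).1 : Plane) ∈ D.cell c → (D.sheet (Γ s) c).val.head? = some c) ↔
      (∀ c, ((Γ t).1 : Plane) ∈ D.cell c → (D.sheet (Γ t) c).val.head? = some c) := by
    intro s t
    refine isPreconnected_univ.induction₂ (fun s t : I =>
      (∀ c, ((Γ s).1 : Plane) ∈ D.cell c → (D.sheet (Γ s) c).val.head? = some c) ↔
      (∀ c, ((Γ t).1 : Plane) ∈ D.cell c → (D.sheet (Γ t) c).val.head? = some c))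
      (fun t _ => ?_) (fun _ _ _ _ _ _ h h' => h.trans h') (fun _ _ _ _ h => h.symm)
      (mem_univ s) (mem_univ t)
    rw [nhdsWithin_univ]
    filter_upwards [hev t] with s hs
    constructor
    · intro h c hc
      rw [(hs c hc).2]
      exact h c (hs c hc).1
    · intro h c hc
      have h1 := D.mem_cellAt (Γ s).1
      have h2 := h _ h1
      rw [(hs _ h1).2] at h2
      exact D.head?_sheet (Γ t) (hs _ h1).1 hc h2
  have hgood : ∀ t c, ((Γ t).1 : Plane) ∈ D.cell c → (D.sheet (Γ t) c).val.head? = some c := by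
    intro t
    refine (hhead 0 t).1 fun c hc => ?_
    refine D.head?_sheet (Γ 0) (a := i) ?_ hc (by rw [h0]; rfl)
    rw [hΓ, γ.source]
    exact hi
  refine ⟨h0, fun t c hc => hgood t c ((hcell t c).2 hc), fun t c d hc hd hcd => ?_, fun t => ?_⟩
  · have hc' := (hcell t c).2 hc
    have hd' := (hcell t d).2 hd
    change (D.sheet (Γ t) d).val = ConvexDissection.step d (D.sheet (Γ t) c).val
    rw [D.sheet_adj (Γ t) hc' hd' hcd, ReducedWalk.swap_of_head hcd.1 (hgood t c hc')]
  · filter_upwards [hev t] with s hs c hc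
    have := hs c ((hcell s c).2 hc)
    exact ⟨(hcell t c).1 this.1, congrArg ReducedWalk.val this.2⟩

/-- Homotopic paths have lifts with the same end. -/
theorem exists_isLift {x₀ x₁ : X.carrier} {γ γ' : Path x₀ x₁} (h : γ.Homotopic γ') {i : ι}
    (hi : (x₀ : Plane) ∈ D.cell i) :
    ∃ w w', D.IsLift γ i w ∧ D.IsLift γ' i w' ∧ w 1 = w' 1 := by
  -- The point over `x₀` whose label in the cell `i` is the walk `[i]`.
  let z : D.coveringCore.TotalSpace := ⟨x₀, (D.pot x₀ i).symm ⟨[i], trivial⟩⟩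
  have hz : (D.sheet z i).val = [i] := by simp [sheet, z]
  have hcov := D.isCoveringMap_proj
  have h0 : ∀ γ : Path x₀ x₁, (γ : C(I, X.carrier)) 0 = D.coveringCore.proj z := fun γ => γ.source
  have key : ∀ γ : Path x₀ x₁, D.IsLift γ i fun t c =>
      (D.sheet (hcov.liftPath γ z (h0 γ) t) c).val := by
    intro γ
    refine D.isLift_of_lift γ _ (fun t => ?_) hi ?_
    · exact congrFun (hcov.liftPath_lifts γ z (h0 γ)) t
    · rw [hcov.liftPath_zero]
      exact hz
  refine ⟨_, _, key γ, key γ', ?_⟩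
  have := hcov.liftPath_apply_one_eq_of_homotopicRel h z (h0 γ) (h0 γ')
  exact funext fun c => congrArg (fun y => (D.sheet y c).val) this

end ConvexDivision

end ConvexDissection

/-! ### Lifts of paths, their passage through sheets and their codes -/

namespace ConvexDissection

open Filter Topology Path

/-- A step changes the list by at most one entry at its head, so it can enter or leave the lists
ending in `D` only through `D` itself. This is the separation property of a node in a tree. -/
theorem suffix_iff_suffix_step {ι : Type*} {D L : List ι} {c : ι} (hD : D ≠ []) (h1 : L ≠ D)
    (h2 : step c L ≠ D) : D <:+ L ↔ D <:+ step c L := by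
  have h1' := h1.symm
  have h2' := h2.symm
  rcases L with _ | ⟨a, _ | ⟨b, l⟩⟩
  · simp_all [step, List.suffix_cons_iff]
  · by_cases hac : a = c
    · simp [step, hac]
    · simp_all [step, List.suffix_cons_iff]
  · by_cases hac : a = c
    · simp [step, hac]
    · by_cases hbc : b = c
      · simp only [step, hac, hbc, if_true, if_false] at h2' ⊢
        subst hbc
        rw [List.suffix_cons_iff (a := a)]
        simp [h1']
      · simp only [step, hac, hbc, if_false] at h2' ⊢
        rw [List.suffix_cons_iff (a := c)]
        simp [h2']

namespace ConvexDivision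

variable {X : PolygonalRegion} {ι : Type*} {D : ConvexDivision X ι}
  {x₀ x₁ : X.carrier} {γ : Path x₀ x₁} {i j k : ι} {w : I → ι → List ι}

theorem IsLift.step_of_eq_or_adj (h : D.IsLift γ i w) (t : I) {c d : ι}
    (hc : (γ t : Plane) ∈ D.cell c) (hd : (γ t : Plane) ∈ D.cell d)
    (hcd : c = d ∨ D.graph.Adj c d) :
    w t d = ConvexDissection.step d (w t c) := by
  rcases hcd with rfl | hcd
  · rw [step_eq_self (h.head t hc)]
  · exact h.step t hc hd hcd

theorem IsLift.eq_of_forall_mem (h : D.IsLift γ i w) {s t : I} (hst : s ≤ t) {c : ι}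
    (hc : ∀ r ∈ Set.Icc s t, (γ r : Plane) ∈ D.cell c) : w t c = w s c := by
  refine (isPreconnected_Icc (a := s) (b := t)).induction₂ (fun s t => w t c = w s c)
    (fun r _ => ?_) (fun _ _ _ _ _ _ h h' => h'.trans h) (fun _ _ _ _ h => h.symm)
    (left_mem_Icc.2 hst) (right_mem_Icc.2 hst)
  filter_upwards [nhdsWithin_le_nhds (h.eventually_eq r), self_mem_nhdsWithin] with q hq hqI
  exact (hq c (hc q hqI)).2

theorem IsLift.eq_foldl (h : D.IsLift γ i w) : ∀ (a : ι) (l : List ι) (t : Fin (l.length + 2) → I),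
    Monotone t → (a :: l).IsChain (fun a b => a = b ∨ D.graph.Adj a b) →
    (∀ n : Fin (l.length + 1), ∀ s ∈ Set.Icc (t n.castSucc) (t n.succ),
      (γ s : Plane) ∈ D.cell ((a :: l).get n)) →
    ∀ b, (a :: l).getLast? = some b →
    w (t (Fin.last _)) b = l.foldl (fun L c => ConvexDissection.step c L) (w (t 0) a)
  | a, [], t, ht, _, hcell, b, hb => by
    obtain rfl : a = b := by simpa using hb
    exact h.eq_of_forall_mem (ht (Fin.zero_le _)) (hcell (0 : Fin 1))
  | a, c :: l, t, ht, hch, hcell, b, hb => by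
    have h1 : w (t 1) a = w (t 0) a :=
      h.eq_of_forall_mem (ht (Fin.zero_le _)) (hcell (0 : Fin (l.length + 2)))
    have ha : (γ (t 1) : Plane) ∈ D.cell a :=
      hcell (0 : Fin (l.length + 2)) _ (right_mem_Icc.2 (ht (Fin.zero_le _)))
    have hc : (γ (t 1) : Plane) ∈ D.cell c :=
      hcell (1 : Fin (l.length + 2)) _ (left_mem_Icc.2 (ht (Fin.castSucc_le_succ _)))
    have hch' := List.isChain_cons_cons.1 hch
    have h2 := h.step_of_eq_or_adj (t 1) ha hc hch'.1
    have h3 := h.eq_foldl c l (fun n => t n.succ) (fun m n hmn => ht (Fin.succ_le_succ_iff.2 hmn))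
      hch'.2 (fun n s hs => hcell n.succ s hs) b (by simpa using hb)
    rw [List.foldl_cons, ← h1, ← h2]
    exact h3

/-- On each interval of the code the label of the current cell is constant, and at each division
point it makes one `step`; this is the recursion that defines `dev`. -/
theorem IsLift.eq_dev (h : D.IsLift γ i w) {u : TopoPath D.graph i j} (hu : D.IsCode γ u) :
    w 1 j = dev u.nodes := by
  obtain ⟨t, ht, h0, h1, hcell⟩ := hu
  obtain ⟨l, hch, hhd, hlast⟩ := u
  rcases l with _ | ⟨a, l⟩
  · simp at hhd
  · obtain rfl : a = i := by simpa using hhd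
    have := h.eq_foldl a l t ht hch hcell j hlast
    change t (0 : Fin (l.length + 2)) = 0 at h0
    change t (Fin.last (l.length + 1)) = 1 at h1
    rw [h0, h1, h.zero] at this
    exact this

variable [Finite ι]

theorem IsLift.suffix_of_suffix (h : D.IsLift γ i w) (t : I) {L : List ι} (hL : L ≠ [])
    (hne : ∀ c, (γ t : Plane) ∈ D.cell c → w t c ≠ L) {a b : ι} (ha : (γ t : Plane) ∈ D.cell a)
    (hb : (γ t : Plane) ∈ D.cell b) (hs : L <:+ w t a) : L <:+ w t b := by
  induction D.reflTransGen_adj_of_mem ha hb with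
  | refl => exact hs
  | tail _ hab ih =>
    obtain ⟨hadj, ha', hb'⟩ := hab
    have e := h.step t ha' hb' hadj
    rw [e, ← suffix_iff_suffix_step hL (hne _ ha') (by rw [← e]; exact hne _ hb')]
    exact ih ha'

/-- A lift that ends beyond a sheet and does not start beyond it runs through this sheet. -/
theorem IsLift.exists_eq (h : D.IsLift γ i w) {L : List ι} (hL : L.head? = some k) {t₀ : I} {a : ι}
    (ha : (γ t₀ : Plane) ∈ D.cell a) (h0 : L <:+ w t₀ a → w t₀ a = L)
    (hj : (x₁ : Plane) ∈ D.cell j) (h1 : L <:+ w 1 j) :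
    ∃ s, t₀ ≤ s ∧ (γ s : Plane) ∈ D.cell k ∧ w s k = L := by
  by_contra! hc
  have hL0 : L ≠ [] := by rintro rfl; simp at hL
  have hne : ∀ s, t₀ ≤ s → ∀ c, (γ s : Plane) ∈ D.cell c → w s c ≠ L := by
    intro s hs c hcs e
    have := h.head s hcs
    rw [e, hL] at this
    obtain rfl := Option.some.inj this
    exact hc s hs hcs e
  -- As long as the sheet `L` is avoided, being beyond it is preserved both by changes of cell at
  -- one point and by small changes of time, so it is constant on the interval.
  have key : (∃ c, (γ t₀ : Plane) ∈ D.cell c ∧ L <:+ w t₀ c) ↔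
      (∃ c, (γ 1 : Plane) ∈ D.cell c ∧ L <:+ w 1 c) := by
    refine (isPreconnected_Icc (a := t₀) (b := 1)).induction₂
      (fun s t => (∃ c, (γ s : Plane) ∈ D.cell c ∧ L <:+ w s c) ↔
        (∃ c, (γ t : Plane) ∈ D.cell c ∧ L <:+ w t c))
      (fun r hr => ?_) (fun _ _ _ _ _ _ h h' => h.trans h') (fun _ _ _ _ h => h.symm)
      (left_mem_Icc.2 unitInterval.le_one') (right_mem_Icc.2 unitInterval.le_one')
    filter_upwards [nhdsWithin_le_nhds (h.eventually_eq r)] with q hq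
    constructor
    · rintro ⟨c, hcr, hLc⟩
      have h2 := D.mem_cellAt (γ q)
      refine ⟨_, h2, ?_⟩
      rw [(hq _ h2).2]
      exact h.suffix_of_suffix r hL0 (hne r hr.1) hcr (hq _ h2).1 hLc
    · rintro ⟨c, hcq, hLc⟩
      rw [(hq c hcq).2] at hLc
      exact ⟨c, (hq c hcq).1, hLc⟩
  obtain ⟨c, hc0, hLc⟩ := key.2 ⟨j, by rwa [γ.target], h1⟩
  have := h.suffix_of_suffix t₀ hL0 (hne t₀ le_rfl) hc0 ha hLc
  exact hne t₀ le_rfl a ha (h0 this)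

theorem IsLift.codes_of_codes (h : D.IsLift γ i w) (t : I) {y : X.carrier} {a b : ι}
    {κ : Homotopic.Quotient y (γ t)} (ha : (γ t : Plane) ∈ D.cell a)
    (hb : (γ t : Plane) ∈ D.cell b) (hκ : Codes D.cell (w t a).reverse κ) :
    Codes D.cell (w t b).reverse κ := by
  induction D.reflTransGen_adj_of_mem ha hb with
  | refl => exact hκ
  | tail _ hab ih =>
    obtain ⟨hadj, ha', hb'⟩ := hab
    rw [h.step t ha' hb' hadj, ← Homotopic.Quotient.trans_refl κ]
    exact (ih ha').step D.convex_cell D.cell_subset (.refl hb')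

omit [Finite ι] in
theorem Codes.trans_inCell_of_head {x y z : X.carrier} {c : ι} {L : List ι}
    (hL : L.head? = some c)
    {κ₁ : Homotopic.Quotient x y} {κ₂ : Homotopic.Quotient y z}
    (h₁ : Codes D.cell L.reverse κ₁) (h₂ : InCell (D.cell c) κ₂) :
    Codes D.cell L.reverse (κ₁.trans κ₂) := by
  rcases L with _ | ⟨a, l⟩
  · simp at hL
  · obtain rfl : a = c := by simpa using hL
    rw [List.reverse_cons] at h₁ ⊢
    exact h₁.trans_inCell h₂

omit [Finite ι] in
/-- Two paths that run in the union of the cells at a common point are homotopic. -/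
theorem homotopic_of_forall_mem_cells {p : Plane} {x y : X.carrier}
    (γ γ' : Path x y) (h : ∀ t, ∃ c, p ∈ D.cell c ∧ (γ t : Plane) ∈ D.cell c)
    (h' : ∀ t, ∃ c, p ∈ D.cell c ∧ (γ' t : Plane) ∈ D.cell c) : γ.Homotopic γ' := by
  have hstar : StarConvex ℝ p (⋃ c : {c // p ∈ D.cell c}, D.cell c) :=
    starConvex_iUnion fun c => (D.convex_cell c).starConvex c.2
  refine homotopic_of_starConvex hstar (iUnion_subset fun c => D.cell_subset c) γ γ'
    (fun t => ?_) fun t => ?_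
  · obtain ⟨c, hc, ht⟩ := h t
    exact mem_iUnion.2 ⟨⟨c, hc⟩, ht⟩
  · obtain ⟨c, hc, ht⟩ := h' t
    exact mem_iUnion.2 ⟨⟨c, hc⟩, ht⟩

-- All cells met close to time `t` contain `γ t`, so this piece of the path runs in a star convex
-- union of cells. It is homotopic there to the segment between its ends, which stays in `c`.
omit [Finite ι] in
theorem IsLift.eventually_inCell_subpath (h : D.IsLift γ i w) (t : I) :
    ∀ᶠ s in 𝓝 t, ∀ c, (γ s : Plane) ∈ D.cell c →
      InCell (D.cell c) (Homotopic.Quotient.mk (γ.subpath t s)) := by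
  have hu : Tendsto (fun s => uIcc t s) (𝓝 t) (𝓝 t).smallSets :=
    tendsto_const_nhds.uIcc tendsto_id
  filter_upwards [h.eventually_eq t,
    hu.eventually (eventually_smallSets_forall.2 (h.eventually_eq t))] with s hs hs' c hc
  have hct := (hs c hc).1
  refine ⟨segmentPath (D.convex_cell c) (D.cell_subset c) hct hc, segmentPath_mem _ _ _ _, ?_⟩
  refine Homotopic.Quotient.eq.2 (homotopic_of_forall_mem_cells _ _
    (fun r => ⟨c, hct, segmentPath_mem _ _ _ _ r⟩) fun r => ?_)
  have hr : γ.subpath t s r ∈ γ '' uIcc t s := by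
    rw [← Path.range_subpath]
    exact mem_range_self r
  obtain ⟨q, hq, e⟩ := hr
  rw [← e]
  have h2 := D.mem_cellAt (γ q)
  exact ⟨_, (hs' q hq _ h2).1, h2⟩

/-- The property is locally constant in `t`: a short piece of the path is absorbed by the last cell
of the walk. Connectedness of the interval replaces induction along a finite code, which need not
exist. -/
theorem IsLift.codes (h : D.IsLift γ i w) (hi : (x₀ : Plane) ∈ D.cell i) (t : I) {a : ι}
    (ha : (γ t : Plane) ∈ D.cell a) :
    Codes D.cell (w t a).reverse (Homotopic.Quotient.mk (γ.subpath 0 t)) := by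
  let P : I → Prop := fun t => ∀ a, (γ t : Plane) ∈ D.cell a →
    Codes D.cell (w t a).reverse (Homotopic.Quotient.mk (γ.subpath 0 t))
  have h0 : P 0 := by
    have hi0 : (γ 0 : Plane) ∈ D.cell i := by rwa [γ.source]
    refine fun a ha => h.codes_of_codes 0 hi0 ha ?_
    rw [h.zero, Path.subpath_self]
    exact codes_singleton.2 (.refl hi0)
  have key : P 0 ↔ P t := by
    refine isPreconnected_univ.induction₂ (fun s t => P s ↔ P t)
      (fun r _ => ?_) (fun _ _ _ _ _ _ h h' => h.trans h') (fun _ _ _ _ h => h.symm)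
      (mem_univ 0) (mem_univ t)
    rw [nhdsWithin_univ]
    filter_upwards [h.eventually_eq r, h.eventually_inCell_subpath r] with q hq hq'
    constructor
    · intro hr a ha
      obtain ⟨har, e⟩ := hq a ha
      rw [e, ← mk_subpath_trans γ 0 r q]
      exact Codes.trans_inCell_of_head (h.head r har) (hr a har) (hq' a ha)
    · intro hPq a ha
      have h2 := D.mem_cellAt (γ q)
      obtain ⟨h3, e⟩ := hq _ h2
      have h4 := hPq _ h2
      rw [e] at h4
      refine h.codes_of_codes r h3 ha ?_
      rw [← mk_subpath_trans γ 0 q r]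
      refine Codes.trans_inCell_of_head (h.head r h3) h4 ?_
      have := (hq' _ h2).symm
      rwa [← Homotopic.Quotient.mk_symm, Path.symm_subpath] at this
  exact key.1 h0 a ha

end ConvexDivision

end ConvexDissection

/-! ### Products of walks, lengths of shortcuts and the theorem -/

namespace ConvexDissection

open Path

/-- Since `push` inspects only the head, the entries added by `m` depend on the junction `k` and not
on what precedes it. Thus `h₃` contributes the same entries after `h₁` and after `h₁ * h₂`. -/
theorem exists_foldl_push_eq {V : Type*} (k : V) (m : List V) :
    ∃ s : List V, ∀ L : List V, L.head? = some k → m.foldl (fun L c => push c L) L = s ++ L := by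
  induction m using List.reverseRecOn with
  | nil => exact ⟨[], fun L _ => rfl⟩
  | append_singleton m a ih =>
    obtain ⟨s, hs⟩ := ih
    rcases s with _ | ⟨b, s⟩
    · by_cases hka : k = a
      · refine ⟨[], fun L hL => ?_⟩
        rw [List.foldl_concat, hs L hL]
        exact push_eq_self (hka ▸ hL)
      · refine ⟨[a], fun L hL => ?_⟩
        rw [List.foldl_concat, hs L hL]
        rcases L with _ | ⟨c, L⟩
        · simp at hL
        · obtain rfl : c = k := by simpa using hL
          simp [push, hka]
    · by_cases hba : b = a
      · exact ⟨b :: s, fun L hL => by rw [List.foldl_concat, hs L hL]; simp [push, hba]⟩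
      · exact ⟨a :: b :: s, fun L hL => by rw [List.foldl_concat, hs L hL]; simp [push, hba]⟩

section Length

variable {X : PolygonalRegion} {x y z : X.carrier}

theorem eVariationOn_le_of_eqOn {f : I → Plane} {g : Path x y} {s : Set I} {φ : I → I}
    {t : Set I} (hφ : MonotoneOn φ s) (hst : MapsTo φ s t)
    (h : ∀ r ∈ s, f r = g (φ r)) :
    eVariationOn f s ≤ eVariationOn (fun r => (g r : Plane)) t := by
  rw [eVariationOn.congr (g := (fun r => (g r : Plane)) ∘ φ) h]
  exact eVariationOn.comp_le_of_monotoneOn _ φ hφ hst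

theorem pathLength_trans_le (p : Path x y) (q : Path y z) :
    pathLength (p.trans q) ≤ pathLength p + pathLength q := by
  let m : I := ⟨1 / 2, by norm_num, by norm_num⟩
  have e := eVariationOn.Icc_add_Icc (fun r => (p.trans q r : Plane)) (s := univ) (a := 0) (b := m)
    (c := 1) unitInterval.nonneg' unitInterval.le_one' (mem_univ _)
  simp only [univ_inter] at e
  have e' : pathLength (p.trans q) = eVariationOn (fun r => (p.trans q r : Plane)) (Icc 0 1) := by
    rw [pathLength, ← Icc_bot_top]; rfl
  rw [e', ← e]
  refine add_le_add (eVariationOn_le_of_eqOn (φ := fun r => projIcc 0 1 zero_le_one (2 * (r : ℝ)))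
      (fun a _ b _ hab => monotone_projIcc _ ?_) (mapsTo_univ _ _) fun r hr => ?_)
    (eVariationOn_le_of_eqOn (φ := fun r => projIcc 0 1 zero_le_one (2 * (r : ℝ) - 1))
      (fun a _ b _ hab => monotone_projIcc _ ?_) (mapsTo_univ _ _) fun r hr => ?_)
  · exact mul_le_mul_of_nonneg_left hab zero_le_two
  · have hr' : (r : ℝ) ≤ 1 / 2 := hr.2
    rw [Path.trans_apply, dif_pos hr', projIcc_of_mem zero_le_one]
  · exact sub_le_sub_right (mul_le_mul_of_nonneg_left (Subtype.coe_le_coe.2 hab) zero_le_two) 1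
  · have hr' : 1 / 2 ≤ (r : ℝ) := hr.1
    rcases hr'.eq_or_lt with h | h
    · have : r = m := Subtype.ext h.symm
      subst this
      norm_num [Path.trans_apply, m]
    · rw [Path.trans_apply, dif_neg h.not_ge, projIcc_of_mem zero_le_one]

theorem pathLength_subpath_le (f : Path x y) {s t : I} (hst : s ≤ t) :
    pathLength (f.subpath s t) ≤ eVariationOn (fun r => (f r : Plane)) (Icc s t) := by
  refine eVariationOn_le_of_eqOn (φ := Icc.convexComb s t) ?_ (fun r _ => ?_) fun r _ => rfl
  · intro a _ b _ hab
    have h1 : (s : ℝ) ≤ t := hst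
    have h2 : (a : ℝ) ≤ b := hab
    change (1 - (a : ℝ)) * s + a * t ≤ (1 - (b : ℝ)) * s + b * t
    nlinarith
  · have := range_subpathAux s t ▸ mem_range_self r
    rwa [uIcc_of_le hst] at this

theorem pathLength_segmentPath_le {c : Set Plane} (hc : Convex ℝ c) (hcX : c ⊆ X.carrier)
    (hx : (x : Plane) ∈ c) (hy : (y : Plane) ∈ c) :
    pathLength (segmentPath hc hcX hx hy) ≤ edist (x : Plane) (y : Plane) := by
  have h1 := (lipschitzWith_lineMap (𝕜 := ℝ) (x : Plane) (y : Plane)).lipschitzOnWith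
    (s := univ)|>.comp_eVariationOn_le (g := fun t : I => (t : ℝ)) (mapsTo_univ _ univ)
  have h2 : eVariationOn (fun t : I => (t : ℝ)) univ ≤ 1 := by
    have := MonotoneOn.eVariationOn_eq (f := fun t : I => (t : ℝ)) (s := univ)
      (fun a _ b _ hab => hab) (mem_univ 0) (mem_univ 1)
    rw [univ_inter, show Icc (0 : I) 1 = univ from Icc_bot_top] at this
    simpa using this.le
  calc _ ≤ _ := h1
    _ ≤ (nndist (x : Plane) (y : Plane) : ℝ≥0∞) * 1 := by gcongr
    _ = _ := by rw [mul_one, edist_nndist]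

/-- Replacing a piece of a path by a segment does not make it longer. -/
theorem pathLength_shortcut_le (f : Path x y) {s t : I} (hst : s ≤ t) {c : Set Plane}
    (hc : Convex ℝ c) (hcX : c ⊆ X.carrier) (hs : (f s : Plane) ∈ c) (ht : (f t : Plane) ∈ c) :
    pathLength (((f.subpath 0 s).trans (segmentPath hc hcX hs ht)).trans (f.subpath t 1)) ≤
      pathLength f := by
  have h1 : pathLength f = eVariationOn (fun r => (f r : Plane)) (Icc 0 s) +
      eVariationOn (fun r => (f r : Plane)) (Icc s t) +
      eVariationOn (fun r => (f r : Plane)) (Icc t 1) := by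
    have e1 := eVariationOn.Icc_add_Icc (fun r => (f r : Plane)) (s := univ) (a := 0) (b := s)
      (c := t) unitInterval.nonneg' hst (mem_univ _)
    have e2 := eVariationOn.Icc_add_Icc (fun r => (f r : Plane)) (s := univ) (a := 0) (b := t)
      (c := 1) unitInterval.nonneg' unitInterval.le_one' (mem_univ _)
    simp only [univ_inter] at e1 e2
    rw [e1, e2, pathLength, ← Icc_bot_top]
    rfl
  rw [h1]
  refine (pathLength_trans_le _ _).trans (add_le_add ((pathLength_trans_le _ _).trans
    (add_le_add (pathLength_subpath_le f unitInterval.nonneg') ?_))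
    (pathLength_subpath_le f unitInterval.le_one'))
  exact (pathLength_segmentPath_le hc hcX hs ht).trans
    (eVariationOn.edist_le _ (left_mem_Icc.2 hst) (right_mem_Icc.2 hst))

end Length

theorem Codes.append_of_last {E : Type*} [NormedAddCommGroup E] [NormedSpace ℝ E] {Y : Set E}
    {ι : Type*} {cell : ι → Set E} {x y z : Y} {l m : List ι} {a : ι}
    {κ₁ : Homotopic.Quotient x y} {κ₂ : Homotopic.Quotient y z}
    (h₁ : Codes cell (l ++ [a]) κ₁) (h₂ : Codes cell (a :: m) κ₂) :
    Codes cell (l ++ a :: m) (κ₁.trans κ₂) := by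
  obtain ⟨w, κ₃, κ₄, h₃, h₄, rfl⟩ := h₂
  rw [← Homotopic.Quotient.trans_assoc]
  simpa using (h₁.trans_inCell h₃).append h₄

namespace TopoPath

variable {V : Type*} {G : SimpleGraph V} {x y z : V}

theorem head?_des_nodes (p : TopoPath G x y) : (des p.nodes).head? = some y := by
  rw [head?_des, p.last_eq]

theorem exists_des_nodes_eq (p : TopoPath G x y) : ∃ l, des p.nodes = y :: l := by
  have := p.head?_des_nodes
  rcases h : des p.nodes with _ | ⟨a, l⟩
  · simp [h] at this
  · exact ⟨l, by simpa [h] using this⟩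

theorem exists_des_mul_eq (q : TopoPath G y z) : ∃ s : List V, ∀ {x : V} (p : TopoPath G x y),
    des (p.mul q).nodes = s ++ des p.nodes := by
  obtain ⟨s, hs⟩ := exists_foldl_push_eq y q.nodes.tail
  exact ⟨s, fun p => by rw [mul, des_append, hs _ p.head?_des_nodes]⟩

end TopoPath

namespace ConvexDivision

variable {X : PolygonalRegion} {ι : Type*} {D : ConvexDivision X ι} {x₀ x₁ : X.carrier} {i j k : ι}

theorem IsCode.left_mem {f : Path x₀ x₁} {u : TopoPath D.graph i j} (h : D.IsCode f u) :
    (x₀ : Plane) ∈ D.cell i := by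
  obtain ⟨l, hch, hhd, hlast⟩ := u
  rcases l with _ | ⟨a, l⟩
  · simp at hhd
  · obtain rfl : a = i := by simpa using hhd
    obtain ⟨_, _, _, h, -⟩ := h.codes
    exact h.left_mem

theorem IsCode.right_mem {f : Path x₀ x₁} {u : TopoPath D.graph i j} (h : D.IsCode f u) :
    (x₁ : Plane) ∈ D.cell j := by
  have hu := h.codes
  rcases List.eq_nil_or_concat' u.nodes with e | ⟨l, a, e⟩
  · simpa [e] using u.head_eq
  · obtain rfl : a = j := by simpa [e] using u.last_eq
    rw [e] at hu
    exact hu.last_mem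

end ConvexDivision

end ConvexDissection

open ConvexDissection Path in
theorem mainTheorem5 (X : ConvexDissection.PolygonalRegion) {ι : Type*} [Finite ι]
    (D : ConvexDissection.ConvexDivision X ι) {x₀ x₁ : X.carrier} (f g : Path x₀ x₁)
    {i k j : ι}
    (h₁ : ConvexDissection.TopoPath D.graph i k)
    (h₂ : ConvexDissection.TopoPath D.graph k k)
    (h₃ : ConvexDissection.TopoPath D.graph k j)
    (cf cg : ConvexDissection.TopoPath D.graph i j)
    (hcf : D.IsReducedCode f cf) (hcg : D.IsReducedCode g cg)
    (hf : cf.TimeHomotopic ((h₁.mul h₂).mul h₃)) (hg : cg.TimeHomotopic (h₁.mul h₃))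
    (fs gs : Path x₀ x₁)
    (hfs : ConvexDissection.IsShortestInClass f fs)
    (hgs : ConvexDissection.IsShortestInClass g gs) :
    ConvexDissection.pathLength gs ≤ ConvexDissection.pathLength fs := by
  obtain ⟨hcf₁, f', u, hff', hu, hucf⟩ := hcf
  have hi := hu.left_mem
  have hj := hu.right_mem
  -- The path `f'` has a finite code, while `fs` may have none; being homotopic, their lifts have
  -- the same end.
  obtain ⟨w, w', hw, hw', e⟩ := D.exists_isLift (hfs.1.symm.trans hff') hi
  obtain ⟨r₃, hr₃⟩ := h₃.exists_des_mul_eq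
  obtain ⟨r₂, hr₂⟩ := h₂.exists_des_mul_eq
  obtain ⟨l₁, hl₁⟩ := h₁.exists_des_nodes_eq
  obtain ⟨l₂, hl₂⟩ := (h₁.mul h₂).exists_des_nodes_eq
  have hw1 : w 1 j = r₃ ++ k :: l₂ := by
    rw [e, hw'.eq_dev hu, hucf.dev_eq, dev_eq_des hcf₁.reduced_des, hf.des_eq, hr₃, hl₂]
  have hcg' : (dev cg.nodes).reverse = l₁.reverse ++ k :: r₃.reverse := by
    rw [dev_eq_des hcg.1.reduced_des, hg.des_eq, hr₃, hl₁]
    simp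
  have hsuf : k :: l₁ <:+ k :: l₂ := ⟨r₂, by rw [← hl₁, ← hl₂, hr₂]⟩
  have hi0 : (fs 0 : Plane) ∈ D.cell i := by rwa [fs.source]
  -- The first sheet is that of `h₁`. The lift starts at `[i]`, which is too short to lie strictly
  -- beyond it.
  obtain ⟨s, -, hs, hws⟩ := hw.exists_eq (L := k :: l₁) rfl hi0
    (fun h => by
      rw [hw.zero] at h ⊢
      exact (h.eq_of_length_le (by simp)).symm) hj
    (hw1 ▸ hsuf.trans (List.suffix_append _ _))
  -- Starting from time `s`, the lift still has to reach the sheet of `h₁ * h₂`, which gives `s ≤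
  -- t`.
  obtain ⟨t, hst, ht, hwt⟩ := hw.exists_eq (L := k :: l₂) rfl hs
    (fun h => by
      rw [hws] at h ⊢
      exact (hsuf.eq_of_length_le h.length_le)) hj
    (hw1 ▸ List.suffix_append _ _)
  have c₁ := hw.codes hi s hs
  have c₂ := hw.codes hi t ht
  have c₃ := hw.codes hi 1 (a := j) (by rwa [fs.target])
  rw [hws, List.reverse_cons] at c₁
  rw [hwt, List.reverse_cons] at c₂
  rw [hw1, ← mk_subpath_trans fs 0 t 1] at c₃
  -- The part of `fs` after time `t` is coded by the walk of `h₃` alone, which can be attached to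
  -- the walk of `h₁` after a segment in the cell `k`.
  have c₄ := c₂.cancel_left D.convex_cell D.cell_subset (r := r₃.reverse) (by simpa using c₃)
  let τ := segmentPath (D.convex_cell k) (D.cell_subset k) hs ht
  have c₅ := (c₁.trans_inCell (κ₂ := Homotopic.Quotient.mk τ)
    ⟨τ, segmentPath_mem _ _ _ _, rfl⟩).append_of_last c₄
  let W : Path x₀ x₁ :=
    (((fs.subpath 0 s).trans τ).trans (fs.subpath t 1)).cast fs.source.symm fs.target.symm
  have c₆ : Codes D.cell (l₁.reverse ++ k :: r₃.reverse) (Homotopic.Quotient.mk W) :=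
    (codes_cast fs.source.symm fs.target.symm).2 c₅
  have hgW : g.Homotopic W :=
    Homotopic.Quotient.eq.1 ((hcg' ▸ hcg.codes).eq D.convex_cell D.cell_subset c₆)
  exact (hgs.2 W hgW).trans (pathLength_shortcut_le fs hst _ _ hs ht)
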